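/- Let $(X,\rho)$ be a metric space with its Borel $\sigma$-algebra. For probability measures $p,q$ on $X$ let $W_\rho(p,q)=\inf_M\int \rho(x,y)\,dM(x,y)$, the infimum being over all couplings $M$ of $p$ and $q$. For a known distribution $p$ on $X$ and $\varepsilon>0$, an $n$-sample tester for $\mathrm{WIT}(X,\rho,p,\varepsilon)$ is a (possibly randomized) algorithm which draws $n$ i.i.d. samples from an unknown probability distribution $q$ on $X$, accepts with probability at least $2/3$ if $q=p$, and rejects with probability at least $2/3$ if $W_\rho(p,q)\ge\varepsilon$. The sample complexity of $\mathrm{WIT}(X,\rho,p,\varepsilon)$ is the least $n$ for which an $n$-sample tester exists. Let $d\ge 1$ be an integer, let $X$ be the hypercube $[0,1]^d$ or the closed unit ball $B_d(0,1)\subset\mathbb{R}^d$, let $\rho$ be the Euclidean metric and let $\mathcal U$ be the uniform distribution (normalized Lebesgue measure) on $X$. Then the sample complexity $N(\varepsilon)$ of the uniformity testing problem $\mathrm{WIT}(X,\rho,\mathcal U,\varepsilon)$ satisfies $$N(\varepsilon)=\tilde\Theta\left(\varepsilon^{-\max\{2,d/2\}}\right)\qquad(\varepsilon\to 0^+),$$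 that is, there are constants $c,C,\varepsilon_0>0$ and $k\in\mathbb{N}$, depending only on $d$ (and on which of the two sets is taken), such that for all $0<\varepsilon<\varepsilon_0$ $$\frac{c\,\varepsilon^{-\max\{2,d/2\}}}{\log^k(1/\varepsilon)}\le N(\varepsilon)\le C\,\varepsilon^{-\max\{2,d/2\}}\log^k(1/\varepsilon).$$ -/

import Mathlib

open MeasureTheory Filter Topology
open scoped ENNReal

namespace WIT

/-- `M` is a coupling of `p` and `q`: its two marginals are `p` and `q`. -/
def IsCoupling {X : Type*} [MeasurableSpace X] (p q : Measure X) (M : Measure (X × X)) : Prop :=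
  M.map Prod.fst = p ∧ M.map Prod.snd = q

/-- The Wasserstein (transportation) distance of two distributions on a metric space. -/
noncomputable def wasserstein {X : Type*} [MetricSpace X] [MeasurableSpace X]
    (p q : Measure X) : ℝ≥0∞ :=
  ⨅ (M : Measure (X × X)) (_ : IsCoupling p q M), ∫⁻ z, edist z.1 z.2 ∂M

/-- A (randomized) algorithm that draws `n` samples from a distribution on `X` and then accepts or
rejects: `acceptProb x` is the probability, over the internal randomness of the algorithm, that it
accepts when the samples are `x 0, …, x (n - 1)`. -/
structure Tester (X : Type*) [MeasurableSpace X] (n : ℕ) where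
  acceptProb : (Fin n → X) → ℝ≥0∞
  measurable_acceptProb : Measurable acceptProb
  acceptProb_le_one : ∀ x, acceptProb x ≤ 1

/-- The probability that the tester accepts when its samples are i.i.d. from `q`. -/
noncomputable def Tester.probAccepts {X : Type*} [MeasurableSpace X] {n : ℕ}
    (T : Tester X n) (q : Measure X) : ℝ≥0∞ :=
  ∫⁻ x, T.acceptProb x ∂(Measure.pi fun _ : Fin n => q)

/-- The probability that the tester rejects when its samples are i.i.d. from `q`. -/
noncomputable def Tester.probRejects {X : Type*} [MeasurableSpace X] {n : ℕ}
    (T : Tester X n) (q : Measure X) : ℝ≥0∞ :=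
  ∫⁻ x, (1 - T.acceptProb x) ∂(Measure.pi fun _ : Fin n => q)

/-- The tester solves the Wasserstein identity testing problem for the known distribution `p` and
the proximity parameter `ε`. -/
def Tester.Solves {X : Type*} [MetricSpace X] [MeasurableSpace X] {n : ℕ}
    (T : Tester X n) (p : Measure X) (ε : ℝ) : Prop :=
  ∀ q : Measure X, IsProbabilityMeasure q →
    (p = q → 2 / 3 ≤ T.probAccepts q) ∧
    (ENNReal.ofReal ε ≤ wasserstein p q → 2 / 3 ≤ T.probRejects q)

/-- The sample complexity of Wasserstein identity testing for `p` with proximity parameter `ε`: the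
least number of samples with which some tester solves the problem (`∞` if there is none). -/
noncomputable def sampleComplexity {X : Type*} [MetricSpace X] [MeasurableSpace X]
    (p : Measure X) (ε : ℝ) : ℝ≥0∞ :=
  ⨅ (n : ℕ) (_ : ∃ T : Tester X n, T.Solves p ε), (n : ℝ≥0∞)

/-- `N ε = Θ̃ (f ε)` as `ε → 0⁺`: equality up to constant factors and powers of `log (1 / ε)`. -/
def IsThetaTilde (N : ℝ → ℝ≥0∞) (f : ℝ → ℝ) : Prop :=
  ∃ c C : ℝ, ∃ k : ℕ, 0 < c ∧ 0 < C ∧ ∀ᶠ ε : ℝ in 𝓝[>] 0,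
    ENNReal.ofReal (c * f ε / Real.log (1 / ε) ^ k) ≤ N ε ∧
    N ε ≤ ENNReal.ofReal (C * f ε * Real.log (1 / ε) ^ k)

/-- The hypercube `[0,1]^d` in Euclidean space. -/
def cube (d : ℕ) : Set (EuclideanSpace ℝ (Fin d)) :=
  {x | ∀ i, x i ∈ Set.Icc (0 : ℝ) 1}

/-- The closed unit ball of `d`-dimensional Euclidean space. -/
def unitBall (d : ℕ) : Set (EuclideanSpace ℝ (Fin d)) :=
  Metric.closedBall 0 1

/-- The uniform distribution on a set `S` of positive finite volume: normalized Lebesgue measure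
on `S`. -/
noncomputable def uniform {d : ℕ} (S : Set (EuclideanSpace ℝ (Fin d))) : Measure S :=
  (volume S)⁻¹ • Measure.comap ((↑) : S → EuclideanSpace ℝ (Fin d)) volume

end WIT

/-!
The unit cube and the unit ball are treated at once: both are measurable sets between the cubes
`[0, 1 / d]^d` and `[-1, 1]^d` (`IsFat`), and nothing else about them is used.

**Upper bound.** Partition the set into dyadic cubes with sides of order `2 ^ (-i)`, for the levels
`i = 0, …, L`, the finest of order `ε`. Matching as much mass of `p` and `q` as possible inside the
cells, from the finest level to the coarsest, gives a coupling of cost at most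
`D L + ∑ i < L, D i * ∑ c, (p c - q c)⁺`, where `D i` is the diameter of a cell of level `i` and
the inner sum is over the cells of level `i + 1` (`exists_coupling_lintegral_edist_le`). So if
`p` and `q` are at distance at least `ε`, then at some level `i` the vectors of cell masses are at
`ℓ¹`-distance of order at least `2 ^ i * ε / L`. By the Cauchy–Schwarz inequality this bounds their
`ℓ²`-distance from below, which is tested with the inner product of the centred cell counts of the
two halves of the sample (`pairStat`); its mean and variance are computed by conditioning on the
second half. As the cells of level `i` have mass of order at most `2 ^ (-i d)` under the uniform
distribution, level `i` needs about `2 ^ (i (d / 2 - 2)) * ε ^ (-2)` samples, up to powers of `L`,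
which is largest at one of the two ends `2 ^ i ≈ 1` and `2 ^ i ≈ 1 / ε`. The tester that rejects
when some level rejects is `exists_tester_solves`.

**Lower bound.** Choose `m` pairs of disjoint cubic cells of equal size `≈ 1 / K`, with `m = K ^ d`,
and multiply the density by `1 + a` on one cell of each pair and by `1 - a` on the other, with
independent random orders. The perturbed distributions are at distance of order `a / K` from the
uniform one, by testing with a Lipschitz function, whereas the `χ²`-divergence of the mixture of
their `n`-fold products is at most `exp (a ^ 4 * n ^ 2 / (2 * m)) - 1`
(`ten_ninths_le_exp_of_solves`), so that Le Cam's method (`ten_ninths_le_chiSquare`) gives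
`n ≥ c * √m / a ^ 2`. The choice `K = 1`, `a ≈ ε` yields `ε ^ (-2)`, and `K ≈ 1 / ε`, `a = 1`
yields `ε ^ (-d / 2)`.
-/

namespace WIT

/-! ### Transport along a hierarchy of partitions -/

section Transport

variable {X : Type*} [MeasurableSpace X]

lemma measure_eq_tsum_fiber {ι : Type*} [Countable ι] [MeasurableSpace ι]
    [MeasurableSingletonClass ι] {f : X → ι} (hf : Measurable f) (r : Measure X) (A : Set X)
    (hA : MeasurableSet A) : r A = ∑' c, r (A ∩ f ⁻¹' {c}) := by
  have h : A = ⋃ c, A ∩ f ⁻¹' {c} := by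
    ext x; simp
  conv_lhs => rw [h]
  refine measure_iUnion (fun c c' hcc => ?_) fun c => hA.inter (hf (measurableSet_singleton c))
  refine Set.disjoint_left.2 fun x hx hx' => hcc ?_
  have h1 := hx.2
  have h2 := hx'.2
  simp only [Set.mem_preimage, Set.mem_singleton_iff] at h1 h2
  rw [← h1, ← h2]

/-- Greedy matching inside the cells of a partition: as much mass as possible is transported within
each cell, and what is left of the two measures in a cell is the excess of the one over the other. -/
lemma exists_partial_coupling {ι : Type*} [Countable ι] [MeasurableSpace ι]
    [MeasurableSingletonClass ι] {f : X → ι} (hf : Measurable f) (r s : Measure X)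
    [IsFiniteMeasure r] [IsFiniteMeasure s] :
    ∃ (M : Measure (X × X)) (r' s' : Measure X), M.map Prod.fst + r' = r ∧
      M.map Prod.snd + s' = s ∧ (∀ᵐ z ∂M, f z.1 = f z.2) ∧
      (∀ c, r' (f ⁻¹' {c}) = r (f ⁻¹' {c}) - s (f ⁻¹' {c})) ∧
      (∀ c, s' (f ⁻¹' {c}) = s (f ⁻¹' {c}) - r (f ⁻¹' {c})) := by
  have hm : ∀ c, MeasurableSet (f ⁻¹' {c}) := fun c => hf (measurableSet_singleton c)
  set α : ι → ℝ≥0∞ := fun c => r (f ⁻¹' {c})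
  set β : ι → ℝ≥0∞ := fun c => s (f ⁻¹' {c})
  set κ : ι → ℝ≥0∞ := fun c => (max (α c) (β c))⁻¹ with hκ
  have hαf : ∀ c, α c ≠ ∞ := fun c => measure_ne_top _ _
  have hβf : ∀ c, β c ≠ ∞ := fun c => measure_ne_top _ _
  have hκβ : ∀ c, κ c * β c ≤ 1 := fun c =>
    (mul_le_mul_right (le_max_right (α c) (β c)) _).trans (ENNReal.inv_mul_le_one _)
  have hκα : ∀ c, κ c * α c ≤ 1 := fun c =>
    (mul_le_mul_right (le_max_left (α c) (β c)) _).trans (ENNReal.inv_mul_le_one _)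
  have hmin : ∀ c, κ c * α c * β c = min (α c) (β c) := by
    intro c
    by_cases h0 : max (α c) (β c) = 0
    · have h1 : α c = 0 := le_antisymm (h0 ▸ le_max_left _ _) bot_le
      have h2 : β c = 0 := le_antisymm (h0 ▸ le_max_right _ _) bot_le
      simp [h1, h2]
    · rw [mul_assoc, ← max_mul_min (α c), ← mul_assoc, hκ, ENNReal.inv_mul_cancel h0, one_mul]
      exact (max_lt (hαf c).lt_top (hβf c).lt_top).ne
  -- A sum of restrictions of a measure to the cells, scaled cell by cell, evaluated on a cell.
  have hcell : ∀ (t : Measure X) (w : ι → ℝ≥0∞) (c : ι),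
      Measure.sum (fun c' => w c' • t.restrict (f ⁻¹' {c'})) (f ⁻¹' {c}) = w c * t (f ⁻¹' {c}) := by
    intro t w c
    rw [Measure.sum_apply _ (hm c), tsum_eq_single c]
    · simp
    · intro c' hc'
      rw [Measure.smul_apply, Measure.restrict_apply (hm c)]
      have : f ⁻¹' {c} ∩ f ⁻¹' {c'} = ∅ := by
        ext x; simp only [Set.mem_inter_iff, Set.mem_preimage, Set.mem_singleton_iff,
          Set.mem_empty_iff_false, iff_false, not_and]
        intro h h'; exact hc' (h' ▸ h)
      simp [this]
  have hsum : ∀ t : Measure X, Measure.sum (fun c => t.restrict (f ⁻¹' {c})) = t := by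
    intro t
    ext A hA
    rw [Measure.sum_apply _ hA, measure_eq_tsum_fiber hf t A hA]
    simp_rw [Measure.restrict_apply hA]
  have hadd : ∀ (t : Measure X) (w : ι → ℝ≥0∞), (∀ c, w c ≤ 1) →
      Measure.sum (fun c => w c • t.restrict (f ⁻¹' {c})) +
        Measure.sum (fun c => (1 - w c) • t.restrict (f ⁻¹' {c})) = t := by
    intro t w hw
    rw [Measure.sum_add_sum]
    conv_rhs => rw [← hsum t]
    congr 1
    funext c
    rw [← add_smul, add_tsub_cancel_of_le (hw c), one_smul]
  set M : Measure (X × X) := Measure.sum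
    (fun c => κ c • (r.restrict (f ⁻¹' {c})).prod (s.restrict (f ⁻¹' {c}))) with hM
  refine ⟨M, Measure.sum (fun c => (1 - κ c * β c) • r.restrict (f ⁻¹' {c})),
    Measure.sum (fun c => (1 - κ c * α c) • s.restrict (f ⁻¹' {c})), ?_, ?_, ?_, ?_, ?_⟩
  · rw [← hadd r (fun c => κ c * β c) hκβ]
    congr 1
    · rw [hM, Measure.map_sum measurable_fst.aemeasurable]
      congr 1
      funext c
      rw [Measure.map_smul, Measure.map_fst_prod, smul_smul, Measure.restrict_apply_univ]
    · exact (hadd r (fun c => κ c * β c) hκβ).symm ▸ rfl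
  · rw [← hadd s (fun c => κ c * α c) hκα]
    congr 1
    · rw [hM, Measure.map_sum measurable_snd.aemeasurable]
      congr 1
      funext c
      rw [Measure.map_smul, Measure.map_snd_prod, smul_smul, Measure.restrict_apply_univ]
    · exact (hadd s (fun c => κ c * α c) hκα).symm ▸ rfl
  · rw [hM, ae_iff, Measure.sum_apply_eq_zero]
    intro c
    rw [Measure.smul_apply, Measure.prod_restrict]
    have : ((r.prod s).restrict ((f ⁻¹' {c}) ×ˢ (f ⁻¹' {c}))) {a | ¬ f a.1 = f a.2} = 0 := by
      rw [← ae_iff]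
      refine ae_restrict_of_forall_mem ((hm c).prod (hm c)) fun z hz => ?_
      have h1 := hz.1
      have h2 := hz.2
      simp only [Set.mem_preimage, Set.mem_singleton_iff] at h1 h2
      rw [h1, h2]
    rw [this, smul_zero]
  · intro c
    rw [hcell, ENNReal.sub_mul (fun _ _ => hαf c), one_mul]
    change α c - κ c * β c * α c = α c - β c
    rw [mul_right_comm, hmin]
    exact tsub_min
  · intro c
    rw [hcell, ENNReal.sub_mul (fun _ _ => hβf c), one_mul]
    change β c - κ c * α c * β c = β c - α c
    rw [hmin, min_comm]
    exact tsub_min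

/-- A hierarchy of partitions of depth `L` yields a coupling that matches mass greedily from the
finest partition to the coarsest. The mass left over by level `i + 1` is the excess of `r` over `s`
summed over the cells of that level, and it travels at most the diameter `D i` of a cell of
level `i`. -/
theorem exists_coupling_lintegral_edist_le [MetricSpace X] {ι : ℕ → Type*} [∀ i, Countable (ι i)]
    [∀ i, MeasurableSpace (ι i)] [∀ i, MeasurableSingletonClass (ι i)] (f : ∀ i, X → ι i)
    (hf : ∀ i, Measurable (f i)) (h0 : ∀ x y, f 0 x = f 0 y)
    (hcoarse : ∀ i x y, f (i + 1) x = f (i + 1) y → f i x = f i y) (D : ℕ → ℝ≥0∞)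
    (hD : ∀ i x y, f i x = f i y → edist x y ≤ D i) (L : ℕ) :
    ∀ (r s : Measure X) [IsFiniteMeasure r] [IsFiniteMeasure s], r Set.univ = s Set.univ →
      ∃ M, IsCoupling r s M ∧ ∫⁻ z, edist z.1 z.2 ∂M ≤ D L * r Set.univ +
        ∑ i ∈ Finset.range L, D i *
          ∑' c, (r (f (i + 1) ⁻¹' {c}) - s (f (i + 1) ⁻¹' {c})) := by
  induction L with
  | zero =>
    intro r s _ _ hrs
    have hr : (r Set.univ)⁻¹ • (r.prod s) ∈ {M | IsCoupling r s M ∧ M Set.univ = r Set.univ} := by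
      rcases eq_or_ne (r Set.univ) 0 with h | h
      · have h1 : r = 0 := Measure.measure_univ_eq_zero.1 h
        have h2 : s = 0 := Measure.measure_univ_eq_zero.1 (hrs ▸ h)
        subst h1 h2
        simp [IsCoupling]
      · have hc : (r Set.univ)⁻¹ * r Set.univ = 1 :=
          ENNReal.inv_mul_cancel h (measure_ne_top _ _)
        refine ⟨⟨?_, ?_⟩, ?_⟩
        · rw [Measure.map_smul, Measure.map_fst_prod, smul_smul, ← hrs, hc, one_smul]
        · rw [Measure.map_smul, Measure.map_snd_prod, smul_smul, hc, one_smul]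
        · rw [Measure.smul_apply, ← Set.univ_prod_univ, Measure.prod_prod, ← hrs, smul_eq_mul,
            ← mul_assoc, hc, one_mul]
    refine ⟨_, hr.1, ?_⟩
    refine (lintegral_mono (fun z : X × X => hD 0 _ _ (h0 z.1 z.2))).trans ?_
    rw [lintegral_const, hr.2]
    simp
  | succ L ih =>
    intro r s _ _ hrs
    obtain ⟨M, r', s', hr, hs, hM, hr', hs'⟩ := exists_partial_coupling (hf (L + 1)) r s
    have hrr : r' ≤ r := hr ▸ Measure.le_add_left le_rfl
    have hss : s' ≤ s := hs ▸ Measure.le_add_left le_rfl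
    have : IsFiniteMeasure r' := isFiniteMeasure_of_le r hrr
    have : IsFiniteMeasure s' := isFiniteMeasure_of_le s hss
    have hMr : M.map Prod.fst ≤ r := hr ▸ Measure.le_add_right le_rfl
    have hMu1 : M.map Prod.fst Set.univ = M Set.univ := by
      rw [Measure.map_apply measurable_fst .univ, Set.preimage_univ]
    have hMu2 : M.map Prod.snd Set.univ = M Set.univ := by
      rw [Measure.map_apply measurable_snd .univ, Set.preimage_univ]
    have : IsFiniteMeasure M := ⟨by
      rw [← hMu1]; exact (hMr _).trans_lt (measure_lt_top r _)⟩
    have hrs' : r' Set.univ = s' Set.univ := by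
      have h : M Set.univ + r' Set.univ = M Set.univ + s' Set.univ := by
        rw [← hMu1, ← Measure.add_apply, hr, hMu1, ← hMu2, ← Measure.add_apply, hs, hrs]
      exact (ENNReal.add_right_inj (measure_ne_top M _)).1 h
    -- The matched mass does not cross cells of coarser levels either, so it does not affect the
    -- differences at those levels.
    have hle : ∀ i ≤ L + 1, ∀ᵐ z ∂M, f i z.1 = f i z.2 := by
      intro i hi
      refine Nat.decreasingInduction' (P := fun i => ∀ᵐ z ∂M, f i z.1 = f i z.2) ?_ hi hM
      intro k _ _ h
      filter_upwards [h] with z hz using hcoarse _ _ _ hz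
    have hdiff : ∀ i ≤ L + 1, ∀ c, r' (f i ⁻¹' {c}) - s' (f i ⁻¹' {c}) =
        r (f i ⁻¹' {c}) - s (f i ⁻¹' {c}) := by
      intro i hi c
      have hmc := hf i (measurableSet_singleton c)
      have e : M.map Prod.fst (f i ⁻¹' {c}) = M.map Prod.snd (f i ⁻¹' {c}) := by
        rw [Measure.map_apply measurable_fst hmc, Measure.map_apply measurable_snd hmc]
        refine measure_congr ?_
        filter_upwards [hle i hi] with z hz
        refine propext ?_
        change f i z.1 = c ↔ f i z.2 = c
        rw [hz]
      have e1 : r (f i ⁻¹' {c}) = M.map Prod.fst (f i ⁻¹' {c}) + r' (f i ⁻¹' {c}) := by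
        rw [← Measure.add_apply, hr]
      have e2 : s (f i ⁻¹' {c}) = M.map Prod.fst (f i ⁻¹' {c}) + s' (f i ⁻¹' {c}) := by
        rw [e, ← Measure.add_apply, hs]
      rw [e1, e2]
      have hfin := ((hMr (f i ⁻¹' {c})).trans_lt (measure_lt_top r _)).ne
      rw [← tsub_tsub, (ENNReal.cancel_of_ne hfin).add_tsub_cancel_left]
    obtain ⟨M', ⟨hM1, hM2⟩, hM'⟩ := ih r' s' hrs'
    refine ⟨M + M', ⟨?_, ?_⟩, ?_⟩
    · rw [Measure.map_add _ _ measurable_fst, hM1, hr]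
    · rw [Measure.map_add _ _ measurable_snd, hM2, hs]
    · rw [lintegral_add_measure, Finset.sum_range_succ]
      have hA : ∫⁻ z, edist z.1 z.2 ∂M ≤ D (L + 1) * r Set.univ := by
        calc ∫⁻ z, edist z.1 z.2 ∂M ≤ ∫⁻ _, D (L + 1) ∂M :=
              lintegral_mono_ae (by filter_upwards [hM] with z hz using hD _ _ _ hz)
          _ = D (L + 1) * M Set.univ := lintegral_const _
          _ ≤ _ := by rw [← hMu1]; gcongr
      have hB : r' Set.univ =
          ∑' c, (r (f (L + 1) ⁻¹' {c}) - s (f (L + 1) ⁻¹' {c})) := by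
        rw [measure_eq_tsum_fiber (hf (L + 1)) r' _ .univ]
        simp_rw [Set.univ_inter, hr']
      have hC : ∑ i ∈ Finset.range L, D i *
          ∑' c, (r' (f (i + 1) ⁻¹' {c}) - s' (f (i + 1) ⁻¹' {c})) =
          ∑ i ∈ Finset.range L, D i *
          ∑' c, (r (f (i + 1) ⁻¹' {c}) - s (f (i + 1) ⁻¹' {c})) := by
        refine Finset.sum_congr rfl fun i hi => ?_
        have := Finset.mem_range.1 hi
        simp_rw [hdiff (i + 1) (by omega)]
      rw [hC, hB] at hM'
      calc _ ≤ D (L + 1) * r Set.univ + _ := add_le_add hA hM'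
        _ = _ := by ring

end Transport


/-! ### Indistinguishability of a mixture of product distributions -/

section LeCam

variable {X : Type*} [MeasurableSpace X]

lemma isProbabilityMeasure_withDensity_ofReal (p : Measure X) {g : X → ℝ}
    (hg0 : ∀ x, 0 ≤ g x) (hgi : Integrable g p) (hg1 : ∫ x, g x ∂p = 1) :
    IsProbabilityMeasure (p.withDensity fun x => ENNReal.ofReal (g x)) := by
  constructor
  rw [withDensity_apply _ .univ, Measure.restrict_univ,
    ← ofReal_integral_eq_lintegral_ofReal hgi (.of_forall hg0), hg1, ENNReal.ofReal_one]

/-- The `n`-fold product of a distribution with density `g` has the product density. -/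
lemma pi_withDensity_ofReal (p : Measure X) [IsProbabilityMeasure p] {g : X → ℝ}
    (hg0 : ∀ x, 0 ≤ g x) (hgi : Integrable g p) (hg1 : ∫ x, g x ∂p = 1)
    (n : ℕ) :
    Measure.pi (fun _ : Fin n => p.withDensity fun x => ENNReal.ofReal (g x)) =
      (Measure.pi fun _ : Fin n => p).withDensity fun x => ENNReal.ofReal (∏ i, g (x i)) := by
  have := isProbabilityMeasure_withDensity_ofReal p hg0 hgi hg1
  refine Measure.pi_eq fun s hs => ?_
  have hval : ∀ i, (p.withDensity fun x => ENNReal.ofReal (g x)) (s i) =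
      ENNReal.ofReal (∫ x, (s i).indicator g x ∂p) := fun i => by
    rw [withDensity_apply _ (hs i), integral_indicator (hs i),
      ofReal_integral_eq_lintegral_ofReal hgi.integrableOn (.of_forall hg0)]
  have hind : ∀ i x, 0 ≤ (s i).indicator g x := fun i x =>
    Set.indicator_nonneg (fun x _ => hg0 x) x
  have e : (Set.univ.pi s).indicator (fun x : Fin n → X => ENNReal.ofReal (∏ i, g (x i))) =
      fun x => ENNReal.ofReal (∏ i, (s i).indicator g (x i)) := by
    funext x
    by_cases hx : x ∈ Set.univ.pi s
    · rw [Set.indicator_of_mem hx]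
      congr 1
      refine Finset.prod_congr rfl fun i _ => ?_
      rw [Set.indicator_of_mem (hx i trivial)]
    · rw [Set.indicator_of_notMem hx]
      simp only [Set.mem_pi, Set.mem_univ, true_implies, not_forall] at hx
      obtain ⟨i, hi⟩ := hx
      rw [Finset.prod_eq_zero (Finset.mem_univ i) (Set.indicator_of_notMem hi _),
        ENNReal.ofReal_zero]
  rw [withDensity_apply _ (.univ_pi hs), ← lintegral_indicator (.univ_pi hs), e,
    ← ofReal_integral_eq_lintegral_ofReal
      (Integrable.fintype_prod (f := fun i => (s i).indicator g) fun i => hgi.indicator (hs i))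
      (.of_forall fun x => Finset.prod_nonneg fun i _ => hind i _),
    integral_fintype_prod_eq_prod (fun i => (s i).indicator g),
    ENNReal.ofReal_prod_of_nonneg fun i _ => integral_nonneg (hind i)]
  exact Finset.prod_congr rfl fun i _ => (hval i).symm

/-- Le Cam's second moment method. If a tester accepts `p` and rejects every member of a finite
family of distributions with densities `g σ` with respect to `p`, then the `χ²`-divergence of the
uniform mixture of their `n`-fold products from the `n`-fold product of `p` is at least `1 / 9`. -/
theorem ten_ninths_le_chiSquare (p : Measure X) [IsProbabilityMeasure p] {n : ℕ}
    (T : Tester X n) {S : Type*} [Fintype S] [Nonempty S] (g : S → X → ℝ)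
    (hgm : ∀ σ, Measurable (g σ)) (hg0 : ∀ σ x, 0 ≤ g σ x) (hg2 : ∀ σ x, g σ x ≤ 2)
    (hg1 : ∀ σ, ∫ x, g σ x ∂p = 1) (hacc : 2 / 3 ≤ T.probAccepts p)
    (hrej : ∀ σ, 2 / 3 ≤ T.probRejects (p.withDensity fun x => ENNReal.ofReal (g σ x))) :
    10 / 9 ≤ ((Fintype.card S : ℝ) ^ 2)⁻¹ * ∑ σ, ∑ σ', (∫ x, g σ x * g σ' x ∂p) ^ n := by
  set P := Measure.pi fun _ : Fin n => p with hP
  set A : (Fin n → X) → ℝ := fun x => (T.acceptProb x).toReal with hA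
  set G : S → (Fin n → X) → ℝ := fun σ x => ∏ i, g σ (x i) with hG
  set N : ℝ := (Fintype.card S : ℝ) with hN
  have hNpos : 0 < N := by rw [hN]; exact_mod_cast Fintype.card_pos
  have hTtop : ∀ x, T.acceptProb x ≠ ∞ := fun x =>
    ((T.acceptProb_le_one x).trans_lt ENNReal.one_lt_top).ne
  have hAm : Measurable A := T.measurable_acceptProb.ennreal_toReal
  have hA0 : ∀ x, 0 ≤ A x := fun x => ENNReal.toReal_nonneg
  have hA1 : ∀ x, A x ≤ 1 := fun x => ENNReal.toReal_le_of_le_ofReal zero_le_one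
    (by simpa using T.acceptProb_le_one x)
  have hGm : ∀ σ, Measurable (G σ) := fun σ => by
    exact Finset.measurable_prod _ fun i _ => (hgm σ).comp (measurable_pi_apply i)
  have hG0 : ∀ σ x, 0 ≤ G σ x := fun σ x => Finset.prod_nonneg fun i _ => hg0 σ _
  have hG2 : ∀ σ x, G σ x ≤ 2 ^ n := fun σ x => by
    calc G σ x ≤ ∏ _i : Fin n, (2 : ℝ) :=
          Finset.prod_le_prod (fun i _ => hg0 σ _) fun i _ => hg2 σ _
      _ = 2 ^ n := by simp
  have hbdd : ∀ {f : (Fin n → X) → ℝ} (C : ℝ), Measurable f → (∀ x, |f x| ≤ C) → Integrable f P :=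
    fun C hf hC => Integrable.of_bound hf.aestronglyMeasurable C (.of_forall hC)
  have hgint : ∀ σ, Integrable (g σ) p := fun σ =>
    Integrable.of_bound (hgm σ).aestronglyMeasurable 2
      (.of_forall fun x => by rw [Real.norm_eq_abs, abs_of_nonneg (hg0 σ x)]; exact hg2 σ x)
  have hGint : ∀ σ, Integrable (G σ) P := fun σ => hbdd (2 ^ n) (hGm σ) fun x => by
    rw [abs_of_nonneg (hG0 σ x)]; exact hG2 σ x
  have hAint : Integrable A P := hbdd 1 hAm fun x => by
    rw [abs_of_nonneg (hA0 x)]; exact hA1 x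
  have hAGint : ∀ σ, Integrable (fun x => A x * G σ x) P := fun σ =>
    hbdd (2 ^ n) (hAm.mul (hGm σ)) fun x => by
      rw [abs_of_nonneg (mul_nonneg (hA0 x) (hG0 σ x))]
      calc A x * G σ x ≤ 1 * 2 ^ n :=
            mul_le_mul (hA1 x) (hG2 σ x) (hG0 σ x) zero_le_one
        _ = 2 ^ n := one_mul _
  have hGGint : ∀ σ σ', Integrable (fun x => G σ x * G σ' x) P := fun σ σ' =>
    hbdd (2 ^ n * 2 ^ n) ((hGm σ).mul (hGm σ')) fun x => by
      rw [abs_of_nonneg (mul_nonneg (hG0 σ x) (hG0 σ' x))]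
      exact mul_le_mul (hG2 σ x) (hG2 σ' x) (hG0 σ' x) (by positivity)
  have hGone : ∀ σ, ∫ x, G σ x ∂P = 1 := fun σ => by
    rw [hP, integral_fintype_prod_eq_pow (g σ), hg1, one_pow]
  have hGG : ∀ σ σ', ∫ x, G σ x * G σ' x ∂P = (∫ x, g σ x * g σ' x ∂p) ^ n := fun σ σ' => by
    simp_rw [hG, ← Finset.prod_mul_distrib]
    rw [hP, integral_fintype_prod_eq_pow (fun x => g σ x * g σ' x), Fintype.card_fin]
  have hI1 : 2 / 3 ≤ ∫ x, A x ∂P := by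
    rw [Tester.probAccepts] at hacc
    rw [hA, integral_toReal T.measurable_acceptProb.aemeasurable
      (.of_forall fun x => (hTtop x).lt_top)]
    have h1 : ∫⁻ x, T.acceptProb x ∂P ≤ 1 := by
      calc _ ≤ ∫⁻ _, 1 ∂P := lintegral_mono T.acceptProb_le_one
        _ = 1 := by simp
    have := ENNReal.toReal_mono (h1.trans_lt ENNReal.one_lt_top).ne hacc
    simpa using this
  have hI2 : ∀ σ, ∫ x, A x * G σ x ∂P ≤ 1 / 3 := fun σ => by
    have h := hrej σ
    have hm : Measurable fun x => 1 - T.acceptProb x :=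
      measurable_const.sub T.measurable_acceptProb
    rw [Tester.probRejects, pi_withDensity_ofReal p (hg0 σ) (hgint σ) (hg1 σ),
      lintegral_withDensity_eq_lintegral_mul _ (hGm σ).ennreal_ofReal hm] at h
    have e : ∀ x, ((fun x : Fin n → X => ENNReal.ofReal (∏ i, g σ (x i))) *
        fun x => 1 - T.acceptProb x) x = ENNReal.ofReal (G σ x - A x * G σ x) := fun x => by
      have : (1 - T.acceptProb x) = ENNReal.ofReal (1 - A x) := by
        rw [ENNReal.ofReal_sub _ (hA0 x), ENNReal.ofReal_one, ENNReal.ofReal_toReal (hTtop x)]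
      rw [Pi.mul_apply, this, ← ENNReal.ofReal_mul (hG0 σ x)]
      congr 1
      simp only [hG]
      ring
    rw [lintegral_congr e] at h
    have hsub : Integrable (fun x => G σ x - A x * G σ x) P := (hGint σ).sub (hAGint σ)
    have hnn : ∀ x, 0 ≤ G σ x - A x * G σ x := fun x => by
      have := mul_le_mul_of_nonneg_right (hA1 x) (hG0 σ x)
      linarith
    rw [← hP, ← ofReal_integral_eq_lintegral_ofReal hsub (.of_forall hnn),
      integral_sub (hGint σ) (hAGint σ), hGone] at h
    have h2 : (2 / 3 : ℝ≥0∞) = ENNReal.ofReal (2 / 3) := by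
      rw [ENNReal.ofReal_div_of_pos (by norm_num)]; simp
    rw [h2, ENNReal.ofReal_le_ofReal_iff'] at h
    rcases h with h | h
    · linarith
    · norm_num at h
  set R : (Fin n → X) → ℝ := fun x => N⁻¹ * ∑ σ, G σ x with hR
  have hsumint : Integrable (fun x => ∑ σ, G σ x) P := integrable_finsetSum _ fun σ _ => hGint σ
  have hRint : Integrable R P := hsumint.const_mul _
  have hRone : ∫ x, R x ∂P = 1 := by
    rw [hR, integral_const_mul, integral_finsetSum _ fun σ _ => hGint σ]
    simp_rw [hGone]
    simp [hN]
  have hARint : Integrable (fun x => A x * R x) P := by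
    have : (fun x => A x * R x) = fun x => N⁻¹ * ∑ σ, A x * G σ x := by
      funext x; simp only [hR, ← Finset.mul_sum]; ring
    rw [this]
    exact (integrable_finsetSum _ fun σ _ => hAGint σ).const_mul _
  have hAR : ∫ x, A x * R x ∂P ≤ 1 / 3 := by
    have : (fun x => A x * R x) = fun x => N⁻¹ * ∑ σ, A x * G σ x := by
      funext x; simp only [hR, ← Finset.mul_sum]; ring
    rw [this, integral_const_mul, integral_finsetSum _ fun σ _ => hAGint σ]
    calc N⁻¹ * ∑ σ, ∫ x, A x * G σ x ∂P ≤ N⁻¹ * ∑ _σ : S, (1 / 3 : ℝ) := by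
          gcongr with σ; exact hI2 σ
      _ = 1 / 3 := by simp [← hN, hNpos.ne']
  have hR2eq : (fun x => R x ^ 2) = fun x => (N ^ 2)⁻¹ * ∑ σ, ∑ σ', G σ x * G σ' x := by
    funext x
    simp only [hR, ← Finset.mul_sum, ← Finset.sum_mul]
    ring
  have hR2int : Integrable (fun x => R x ^ 2) P := by
    rw [hR2eq]
    exact (integrable_finsetSum _ fun σ _ => integrable_finsetSum _ fun σ' _ =>
      hGGint σ σ').const_mul _
  have hR2 : ∫ x, R x ^ 2 ∂P =
      (N ^ 2)⁻¹ * ∑ σ, ∑ σ', (∫ x, g σ x * g σ' x ∂p) ^ n := by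
    rw [hR2eq, integral_const_mul, integral_finsetSum _ fun σ _ =>
      integrable_finsetSum _ fun σ' _ => hGGint σ σ']
    congr 1
    refine Finset.sum_congr rfl fun σ _ => ?_
    rw [integral_finsetSum _ fun σ' _ => hGGint σ σ']
    exact Finset.sum_congr rfl fun σ' _ => hGG σ σ'
  rw [← hR2]
  have hQint : Integrable (fun x => (1 / 6 + 3 / 2) - 3 * R x) P :=
    (integrable_const _).sub (hRint.const_mul 3)
  have h3 : ∫ x, 3 * R x ∂P = 3 := by rw [integral_const_mul, hRone, mul_one]
  -- Pointwise, `A (1 - R) ≤ 1 / 6 + (3 / 2) (1 - R)²`, since `0 ≤ A ≤ 1`.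
  have key : ∫ x, (A x - A x * R x) ∂P ≤
      ∫ x, ((1 / 6 + 3 / 2) - 3 * R x + 3 / 2 * R x ^ 2) ∂P := by
    refine integral_mono (hAint.sub hARint) (hQint.add (hR2int.const_mul _)) fun x => ?_
    have h1 := hA0 x
    have h2 := hA1 x
    simp only
    nlinarith [sq_nonneg (A x - 3 * (1 - R x)), mul_nonneg h1 (sub_nonneg.2 h2)]
  rw [integral_sub hAint hARint, integral_add hQint (hR2int.const_mul _),
    integral_sub (integrable_const _) (hRint.const_mul 3),
    h3, integral_const_mul] at key
  simp only [integral_const, probReal_univ, smul_eq_mul, one_mul] at key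
  linarith

end LeCam


/-! ### Paninski's perturbations -/

section Perturbation

/-- The easy half of Kantorovich–Rubinstein duality. -/
lemma ofReal_integral_sub_le_wasserstein {X : Type*} [MetricSpace X] [MeasurableSpace X]
    [BorelSpace X] (p q : Measure X) [IsProbabilityMeasure p] {φ : X → ℝ}
    (hφ : LipschitzWith 1 φ) {C : ℝ} (hC : ∀ x, |φ x| ≤ C) :
    ENNReal.ofReal (∫ x, φ x ∂q - ∫ x, φ x ∂p) ≤ wasserstein p q := by
  refine le_iInf₂ fun M hM => ?_
  have hφm : Measurable φ := hφ.continuous.measurable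
  have : IsProbabilityMeasure M := ⟨by
    have : M.map Prod.fst Set.univ = 1 := by rw [hM.1, measure_univ]
    rwa [Measure.map_apply measurable_fst .univ, Set.preimage_univ] at this⟩
  have h1 : Integrable (fun z : X × X => φ z.1) M :=
    Integrable.of_bound (hφm.comp measurable_fst).aestronglyMeasurable C (.of_forall fun z => hC _)
  have h2 : Integrable (fun z : X × X => φ z.2) M :=
    Integrable.of_bound (hφm.comp measurable_snd).aestronglyMeasurable C (.of_forall fun z => hC _)
  have e1 : ∫ x, φ x ∂p = ∫ z, φ z.1 ∂M := by
    rw [← hM.1, integral_map measurable_fst.aemeasurable hφm.aestronglyMeasurable]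
  have e2 : ∫ x, φ x ∂q = ∫ z, φ z.2 ∂M := by
    rw [← hM.2, integral_map measurable_snd.aemeasurable hφm.aestronglyMeasurable]
  rw [e1, e2, ← integral_sub h2 h1]
  calc ENNReal.ofReal (∫ z, (φ z.2 - φ z.1) ∂M) ≤ ‖∫ z, (φ z.2 - φ z.1) ∂M‖ₑ :=
        Real.ofReal_le_enorm _
    _ ≤ ∫⁻ z, ‖φ z.2 - φ z.1‖ₑ ∂M := enorm_integral_le_lintegral_enorm _
    _ ≤ ∫⁻ z, edist z.1 z.2 ∂M := lintegral_mono fun z => by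
        rw [← edist_eq_enorm_sub, edist_comm]
        simpa using hφ z.1 z.2

/-- The sign of a bit. -/
def bitSign (b : Bool) : ℝ := if b then 1 else -1

lemma bitSign_sq (b : Bool) : bitSign b * bitSign b = 1 := by
  cases b <;> simp [bitSign]

lemma abs_bitSign (b : Bool) : |bitSign b| = 1 := by
  cases b <;> simp [bitSign]

variable {X : Type*} {ι : Type*} [Fintype ι]

/-- The perturbation attached to a vector `σ` of bits: on the pair of cells `U (c, true)` and
`U (c, false)` it takes the values `1` and `-1`, in an order that depends on `σ c`. -/
noncomputable def perturbation (U : ι × Bool → Set X) (σ : ι → Bool) (x : X) : ℝ :=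
  ∑ j, bitSign (σ j.1) * bitSign j.2 * (U j).indicator 1 x

lemma sum_mul_indicator_of_mem {U : ι × Bool → Set X}
    (hU : Pairwise fun i j => Disjoint (U i) (U j)) (w : ι × Bool → ℝ) {j : ι × Bool} {x : X}
    (hx : x ∈ U j) : ∑ i, w i * (U i).indicator 1 x = w j := by
  rw [Finset.sum_eq_single j]
  · simp [hx]
  · intro i _ hij
    rw [Set.indicator_of_notMem, mul_zero]
    exact fun h => Set.disjoint_left.1 (hU hij) h hx
  · simp

lemma sum_mul_indicator_of_forall_notMem {U : ι × Bool → Set X} (w : ι × Bool → ℝ) {x : X}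
    (hx : ∀ j, x ∉ U j) : ∑ i, w i * (U i).indicator 1 x = 0 :=
  Finset.sum_eq_zero fun i _ => by rw [Set.indicator_of_notMem (hx i), mul_zero]

lemma abs_perturbation_le {U : ι × Bool → Set X}
    (hU : Pairwise fun i j => Disjoint (U i) (U j)) (σ : ι → Bool) (x : X) :
    |perturbation U σ x| ≤ 1 := by
  by_cases hx : ∃ j, x ∈ U j
  · obtain ⟨j, hj⟩ := hx
    rw [perturbation, sum_mul_indicator_of_mem hU _ hj, abs_mul, abs_bitSign, abs_bitSign, one_mul]
  · rw [perturbation, sum_mul_indicator_of_forall_notMem _ (not_exists.1 hx), abs_zero]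
    exact zero_le_one

lemma perturbation_mul_perturbation {U : ι × Bool → Set X}
    (hU : Pairwise fun i j => Disjoint (U i) (U j)) (σ σ' : ι → Bool) (x : X) :
    perturbation U σ x * perturbation U σ' x =
      ∑ j, bitSign (σ j.1) * bitSign (σ' j.1) * (U j).indicator 1 x := by
  by_cases hx : ∃ j, x ∈ U j
  · obtain ⟨j, hj⟩ := hx
    rw [perturbation, perturbation, sum_mul_indicator_of_mem hU _ hj,
      sum_mul_indicator_of_mem hU _ hj,
      sum_mul_indicator_of_mem hU (fun j => bitSign (σ j.1) * bitSign (σ' j.1)) hj]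
    linear_combination bitSign (σ j.1) * bitSign (σ' j.1) * bitSign_sq j.2
  · rw [perturbation, perturbation, sum_mul_indicator_of_forall_notMem _ (not_exists.1 hx),
      sum_mul_indicator_of_forall_notMem (fun j => bitSign (σ j.1) * bitSign (σ' j.1))
        (not_exists.1 hx), zero_mul]

variable [MeasurableSpace X]

lemma integral_sum_mul_indicator {U : ι × Bool → Set X} (hUm : ∀ j, MeasurableSet (U j))
    (p : Measure X) [IsFiniteMeasure p] {v : ℝ} (hv : ∀ j, p.real (U j) = v)
    (w : ι × Bool → ℝ) :
    ∫ x, ∑ j, w j * (U j).indicator 1 x ∂p = v * ∑ j, w j := by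
  have hi : ∀ j, Integrable (fun x => w j * (U j).indicator 1 x) p := fun j =>
    ((integrable_const (1 : ℝ)).indicator (hUm j)).const_mul (w j)
  rw [integral_finsetSum _ fun j _ => hi j, Finset.mul_sum]
  refine Finset.sum_congr rfl fun j _ => ?_
  rw [integral_const_mul, integral_indicator_one (hUm j), hv, mul_comm]

lemma measurable_perturbation {U : ι × Bool → Set X} (hUm : ∀ j, MeasurableSet (U j))
    (σ : ι → Bool) : Measurable (perturbation U σ) :=
  Finset.measurable_sum _ fun j _ => (measurable_one.indicator (hUm j)).const_mul _

/-- The average of `exp (t ∑ σ c σ' c)` over independent uniform signs is `(cosh t) ^ m`. -/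
lemma sum_sum_exp_bitSign_le (t : ℝ) [DecidableEq ι] :
    ((Fintype.card (ι → Bool) : ℝ) ^ 2)⁻¹ * ∑ σ : ι → Bool, ∑ σ' : ι → Bool,
      Real.exp (t * ∑ c, bitSign (σ c) * bitSign (σ' c)) ≤
        Real.exp (Fintype.card ι * (t ^ 2 / 2)) := by
  have h1 : ∀ σ : ι → Bool, ∑ σ' : ι → Bool,
      Real.exp (t * ∑ c, bitSign (σ c) * bitSign (σ' c)) =
        (2 * Real.cosh t) ^ Fintype.card ι := by
    intro σ
    have h2 : ∀ σ' : ι → Bool, Real.exp (t * ∑ c, bitSign (σ c) * bitSign (σ' c)) =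
        ∏ c, Real.exp (t * (bitSign (σ c) * bitSign (σ' c))) := fun σ' => by
      rw [Finset.mul_sum, Real.exp_sum]
    simp_rw [h2]
    rw [← Fintype.prod_sum (fun c b => Real.exp (t * (bitSign (σ c) * bitSign b)))]
    have h3 : ∀ c, ∑ b, Real.exp (t * (bitSign (σ c) * bitSign b)) = 2 * Real.cosh t := by
      intro c
      rw [Real.cosh_eq, Fintype.sum_bool]
      rcases σ c <;> simp [bitSign] <;> ring
    simp_rw [h3]
    simp
  simp_rw [h1]
  rw [Finset.sum_const, Finset.card_univ, nsmul_eq_mul, mul_pow]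
  have h4 : (Fintype.card (ι → Bool) : ℝ) = 2 ^ Fintype.card ι := by simp
  rw [h4, Real.exp_nat_mul]
  have h5 : (0 : ℝ) < 2 ^ Fintype.card ι := by positivity
  calc _ = Real.cosh t ^ Fintype.card ι := by field_simp
    _ ≤ _ := pow_le_pow_left₀ (Real.cosh_pos t).le (Real.cosh_le_exp_half_sq t) _

/-- Paninski's lower bound. Given `m` pairs of disjoint cells of equal measure, let the mass be
shifted by a factor `1 ± a` between the cells of each pair. As each cell contains a set of measure
at least `β` at distance at least `r` from the complement of the cell, this moves the distribution
by `a m r β`; but `n` samples with `n ≪ √m / a²` do not suffice to see it. -/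
theorem ten_ninths_le_exp_of_solves [MetricSpace X] [BorelSpace X] (p : Measure X)
    [IsProbabilityMeasure p] {U V : ι × Bool → Set X} [Nonempty ι]
    (hU : Pairwise fun i j => Disjoint (U i) (U j)) (hUm : ∀ j, MeasurableSet (U j)) {v : ℝ}
    (hv : ∀ j, p.real (U j) = v) {r β : ℝ} (hr : 0 < r) (hβ : 0 < β)
    (hV : ∀ j, β ≤ p.real (V j)) (hVU : ∀ j, ∀ x ∈ V j, ∀ y ∉ U j, r ≤ dist y x)
    {a ε : ℝ} (ha0 : 0 ≤ a) (ha1 : a ≤ 1) (hε : ε ≤ a * Fintype.card ι * r * β) {n : ℕ}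
    (T : Tester X n) (hT : T.Solves p ε) :
    10 / 9 ≤ Real.exp (a ^ 4 * n ^ 2 / (2 * Fintype.card ι)) := by
  classical
  set m : ℝ := (Fintype.card ι : ℝ) with hm
  have hm0 : 0 < m := by rw [hm]; exact_mod_cast Fintype.card_pos
  set ψ := perturbation U with hψ
  have hψm : ∀ σ, Measurable (ψ σ) := measurable_perturbation hUm
  have hψ1 : ∀ σ x, |ψ σ x| ≤ 1 := abs_perturbation_le hU
  have hψi : ∀ σ, Integrable (ψ σ) p := fun σ =>
    Integrable.of_bound (hψm σ).aestronglyMeasurable 1 (.of_forall (hψ1 σ))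
  have hψψi : ∀ σ σ', Integrable (fun x => ψ σ x * ψ σ' x) p := fun σ σ' =>
    Integrable.of_bound ((hψm σ).mul (hψm σ')).aestronglyMeasurable 1 (.of_forall fun x => by
      rw [Real.norm_eq_abs, abs_mul]
      exact mul_le_one₀ (hψ1 σ x) (abs_nonneg _) (hψ1 σ' x))
  have hψ0 : ∀ σ, ∫ x, ψ σ x ∂p = 0 := fun σ => by
    simp only [hψ, perturbation]
    rw [integral_sum_mul_indicator hUm p hv fun j => bitSign (σ j.1) * bitSign j.2,
      Fintype.sum_prod_type]
    simp [bitSign]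
  have hψψ : ∀ σ σ', ∫ x, ψ σ x * ψ σ' x ∂p =
      2 * v * ∑ c, bitSign (σ c) * bitSign (σ' c) := fun σ σ' => by
    simp only [hψ, perturbation_mul_perturbation hU]
    rw [integral_sum_mul_indicator hUm p hv fun j => bitSign (σ j.1) * bitSign (σ' j.1),
      Fintype.sum_prod_type]
    rw [Finset.mul_sum, Finset.mul_sum]
    exact Finset.sum_congr rfl fun c _ => by rw [Fintype.sum_bool]; ring
  have hv0 : 0 ≤ v := hv (Classical.arbitrary _) ▸ measureReal_nonneg
  -- The cells are disjoint.
  have hvm : 2 * v * m ≤ 1 := by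
    let σ : ι → Bool := fun _ => true
    have h1 := hψψ σ σ
    have h2 : ∫ x, ψ σ x * ψ σ x ∂p ≤ ∫ _, (1 : ℝ) ∂p :=
      integral_mono (hψψi σ σ) (integrable_const _) fun x => by
        have := hψ1 σ x
        simp only
        rw [← sq, ← sq_abs]
        exact pow_le_one₀ (abs_nonneg _) this
    rw [h1] at h2
    simpa [bitSign_sq, ← hm] using h2
  set g : (ι → Bool) → X → ℝ := fun σ x => 1 + a * ψ σ x with hg
  have hgm : ∀ σ, Measurable (g σ) := fun σ => ((hψm σ).const_mul a).const_add 1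
  have haψ : ∀ σ x, |a * ψ σ x| ≤ 1 := fun σ x => by
    rw [abs_mul, abs_of_nonneg ha0]; exact mul_le_one₀ ha1 (abs_nonneg _) (hψ1 σ x)
  have hg0 : ∀ σ x, 0 ≤ g σ x := fun σ x => by
    have := (abs_le.1 (haψ σ x)).1; simp only [hg]; linarith
  have hg2 : ∀ σ x, g σ x ≤ 2 := fun σ x => by
    have := (abs_le.1 (haψ σ x)).2; simp only [hg]; linarith
  have hgi : ∀ σ, Integrable (g σ) p := fun σ => (integrable_const _).add ((hψi σ).const_mul a)
  have hg1 : ∀ σ, ∫ x, g σ x ∂p = 1 := fun σ => by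
    simp only [hg]
    rw [integral_add (integrable_const _) ((hψi σ).const_mul a), integral_const_mul, hψ0]
    simp
  have hgg : ∀ σ σ', ∫ x, g σ x * g σ' x ∂p =
      1 + a ^ 2 * (2 * v * ∑ c, bitSign (σ c) * bitSign (σ' c)) := fun σ σ' => by
    have e : ∀ x, g σ x * g σ' x = g σ x + (a * ψ σ' x + a ^ 2 * (ψ σ x * ψ σ' x)) := fun x => by
      simp only [hg]; ring
    simp_rw [e]
    have hi : Integrable (fun x => a * ψ σ' x + a ^ 2 * (ψ σ x * ψ σ' x)) p :=
      ((hψi σ').const_mul a).add ((hψψi σ σ').const_mul _)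
    rw [integral_add (hgi σ) hi, hg1,
      integral_add ((hψi σ').const_mul a) ((hψψi σ σ').const_mul _), integral_const_mul,
      integral_const_mul, hψ0, hψψ]
    ring
  -- The perturbed distributions are at distance at least `ε` from `p`: test with a signed sum of
  -- bumps around the sets `V j`, supported in the cells. The bumps have disjoint supports, so their
  -- signed sum is Lipschitz with constant `2`.
  have hfar : ∀ σ, ENNReal.ofReal ε ≤
      wasserstein p (p.withDensity fun x => ENNReal.ofReal (g σ x)) := fun σ => by
    set η : ι × Bool → X → ℝ := fun j x => max 0 (r - Metric.infDist x (V j)) with hη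
    have hVne : ∀ j, (V j).Nonempty := fun j => by
      by_contra h
      have := hV j
      rw [Set.not_nonempty_iff_eq_empty.1 h, measureReal_empty] at this
      linarith
    have hη0 : ∀ j x, 0 ≤ η j x := fun j x => le_max_left _ _
    have hηr : ∀ j x, η j x ≤ r := fun j x =>
      max_le hr.le (by have := Metric.infDist_nonneg (x := x) (s := V j); linarith)
    have hηV : ∀ j, ∀ x ∈ V j, η j x = r := fun j x hx => by
      simp only [hη, Metric.infDist_zero_of_mem hx, sub_zero, max_eq_right hr.le]
    have hηU : ∀ j, ∀ x ∉ U j, η j x = 0 := fun j x hx => by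
      have : r ≤ Metric.infDist x (V j) := (Metric.le_infDist (hVne j)).2 fun y hy => hVU j y hy x hx
      simp only [hη]
      exact max_eq_left (by linarith)
    have hηL : ∀ j x y, |η j x - η j y| ≤ dist x y := fun j x y => by
      have h1 := Metric.infDist_le_infDist_add_dist (s := V j) (x := x) (y := y)
      have h2 := Metric.infDist_le_infDist_add_dist (s := V j) (x := y) (y := x)
      rw [dist_comm y x] at h2
      refine (abs_max_sub_max_le_max _ _ _ _).trans (max_le (by simp) ?_)
      rw [abs_le]
      constructor <;> linarith
    set τ : ι × Bool → ℝ := fun j => bitSign (σ j.1) * bitSign j.2 with hτ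
    have hτ1 : ∀ j, |τ j| = 1 := fun j => by simp only [hτ, abs_mul, abs_bitSign, one_mul]
    have hτ2 : ∀ j, τ j * τ j = 1 := fun j => by
      rw [← abs_mul_abs_self, hτ1, one_mul]
    set Φ : X → ℝ := fun x => ∑ j, τ j * η j x with hΦ
    have hΦmem : ∀ j, ∀ x ∈ U j, Φ x = τ j * η j x := fun j x hx => by
      simp only [hΦ]
      refine Finset.sum_eq_single j (fun i _ hij => ?_) (by simp)
      rw [hηU i x fun h => Set.disjoint_left.1 (hU hij) h hx, mul_zero]
    have hΦnot : ∀ x, (∀ j, x ∉ U j) → Φ x = 0 := fun x hx =>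
      Finset.sum_eq_zero fun j _ => by rw [hηU j x (hx j), mul_zero]
    have hΦr : ∀ x, |Φ x| ≤ r := fun x => by
      by_cases hx : ∃ j, x ∈ U j
      · obtain ⟨j, hj⟩ := hx
        rw [hΦmem j x hj, abs_mul, hτ1, one_mul, abs_of_nonneg (hη0 j x)]
        exact hηr j x
      · rw [hΦnot x (not_exists.1 hx), abs_zero]; exact hr.le
    have hΦle : ∀ j, ∀ x ∈ U j, ∀ y ∉ U j, |Φ x| ≤ dist x y := fun j x hx y hy => by
      have := hηL j x y
      rw [hηU j y hy, sub_zero] at this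
      rw [hΦmem j x hx, abs_mul, hτ1, one_mul]
      exact this
    have hΦL : ∀ x y, |Φ x - Φ y| ≤ 2 * dist x y := fun x y => by
      have hd : 0 ≤ dist x y := dist_nonneg
      by_cases hxy : ∃ j, x ∈ U j ∧ y ∈ U j
      · obtain ⟨j, hx, hy⟩ := hxy
        rw [hΦmem j x hx, hΦmem j y hy, ← mul_sub, abs_mul, hτ1, one_mul]
        exact (hηL j x y).trans (by linarith)
      · have h1 : ∀ x y, (¬ ∃ j, x ∈ U j ∧ y ∈ U j) → |Φ x| ≤ dist x y := fun x y hxy => by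
          by_cases hx : ∃ j, x ∈ U j
          · obtain ⟨j, hj⟩ := hx
            exact hΦle j x hj y fun h => hxy ⟨j, hj, h⟩
          · rw [hΦnot x (not_exists.1 hx), abs_zero]; exact dist_nonneg
        have h2 := h1 x y hxy
        have h3 := h1 y x fun ⟨j, hy, hx⟩ => hxy ⟨j, hx, hy⟩
        rw [dist_comm] at h3
        exact (abs_sub _ _).trans (by linarith)
    have hlip : LipschitzWith 1 fun x => Φ x / 2 := LipschitzWith.of_dist_le_mul fun x y => by
      rw [Real.dist_eq, ← sub_div, abs_div, abs_two, NNReal.coe_one, one_mul]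
      linarith [hΦL x y]
    have hΦm : Measurable Φ := by
      have := hlip.continuous.measurable.mul_const 2
      simpa using this
    have hΦi : Integrable (fun x => Φ x / 2) p :=
      Integrable.of_bound (hΦm.div_const 2).aestronglyMeasurable r (.of_forall fun x => by
        rw [Real.norm_eq_abs, abs_div, abs_two]; linarith [hΦr x, abs_nonneg (Φ x)])
    refine le_trans (ENNReal.ofReal_le_ofReal ?_)
      (ofReal_integral_sub_le_wasserstein p _ hlip (C := r) fun x => by
        rw [abs_div, abs_two]; linarith [hΦr x, abs_nonneg (Φ x)])
    have hηm : ∀ j, Measurable (η j) := fun j => by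
      have : Measurable fun x => Metric.infDist x (V j) :=
        (Metric.continuous_infDist_pt _).measurable
      exact measurable_const.max (measurable_const.sub this)
    have hηi : ∀ j, Integrable (η j) p := fun j =>
      Integrable.of_bound (hηm j).aestronglyMeasurable r (.of_forall fun x => by
        rw [Real.norm_eq_abs, abs_of_nonneg (hη0 j x)]; exact hηr j x)
    have hprod : ∀ x, g σ x * (Φ x / 2) = Φ x / 2 + a / 2 * ∑ j, η j x := fun x => by
      have : ψ σ x * Φ x = ∑ j, η j x := by
        by_cases hx : ∃ j, x ∈ U j
        · obtain ⟨j, hj⟩ := hx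
          rw [hΦmem j x hj, hψ, perturbation, sum_mul_indicator_of_mem hU _ hj,
            Finset.sum_eq_single j (fun i _ hij =>
              hηU i x fun h => Set.disjoint_left.1 (hU hij) h hj) (by simp), ← mul_assoc]
          change τ j * τ j * η j x = η j x
          rw [hτ2, one_mul]
        · have hx := not_exists.1 hx
          rw [hΦnot x hx, mul_zero]
          exact (Finset.sum_eq_zero fun j _ => hηU j x (hx j)).symm
      simp only [hg]
      linear_combination a / 2 * this
    have hq : ∫ x, Φ x / 2 ∂(p.withDensity fun x => ENNReal.ofReal (g σ x)) =
        ∫ x, g σ x * (Φ x / 2) ∂p := by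
      rw [integral_withDensity_eq_integral_toReal_smul (hgm σ).ennreal_ofReal
        (.of_forall fun x => ENNReal.ofReal_lt_top)]
      refine integral_congr_ae (.of_forall fun x => ?_)
      simp only [ENNReal.toReal_ofReal (hg0 σ x), smul_eq_mul]
    rw [hq]
    simp_rw [hprod]
    rw [integral_add hΦi ((integrable_finsetSum _ fun j _ => hηi j).const_mul _),
      integral_const_mul, integral_finsetSum _ fun j _ => hηi j, add_sub_cancel_left]
    have hlow : ∀ j, r * β ≤ ∫ x, η j x ∂p := fun j => by
      -- `V j` need not be measurable; its closure is, and the bump is constant on it.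
      have hcl : ∀ x ∈ closure (V j), η j x = r := fun x hx => by
        simp only [hη]
        rw [(Metric.mem_closure_iff_infDist_zero (hVne j)).1 hx, sub_zero, max_eq_right hr.le]
      have hclm : MeasurableSet (closure (V j)) := isClosed_closure.measurableSet
      calc r * β ≤ r * p.real (closure (V j)) := by
            gcongr
            exact (hV j).trans (measureReal_mono subset_closure)
        _ = ∫ x, (closure (V j)).indicator (fun _ => r) x ∂p := by
            rw [integral_indicator_const _ hclm, smul_eq_mul, mul_comm]
        _ ≤ ∫ x, η j x ∂p := integral_mono ((integrable_const r).indicator hclm) (hηi j) fun x => by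
            by_cases hx : x ∈ closure (V j)
            · simp only [Set.indicator_of_mem hx, hcl x hx, le_refl]
            · simp only [Set.indicator_of_notMem hx]; exact hη0 j x
    calc ε ≤ a * m * r * β := hε
      _ = a / 2 * ∑ _j : ι × Bool, r * β := by
          simp [← hm]; ring
      _ ≤ a / 2 * ∑ j, ∫ x, η j x ∂p := by
          gcongr with j; exact hlow j
  have hchi := ten_ninths_le_chiSquare p T g hgm hg0 hg2 hg1 ((hT p ‹_›).1 rfl) fun σ =>
    (hT _ (isProbabilityMeasure_withDensity_ofReal p (hg0 σ) (hgi σ) (hg1 σ))).2 (hfar σ)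
  set t : ℝ := n * (2 * v * a ^ 2) with ht
  have hexp : ∀ σ σ', (∫ x, g σ x * g σ' x ∂p) ^ n ≤
      Real.exp (t * ∑ c, bitSign (σ c) * bitSign (σ' c)) := fun σ σ' => by
    have h0 : 0 ≤ ∫ x, g σ x * g σ' x ∂p :=
      integral_nonneg fun x => mul_nonneg (hg0 σ x) (hg0 σ' x)
    have h1 : ∫ x, g σ x * g σ' x ∂p ≤
        Real.exp (a ^ 2 * (2 * v * ∑ c, bitSign (σ c) * bitSign (σ' c))) := by
      rw [hgg, add_comm]
      exact Real.add_one_le_exp _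
    refine (pow_le_pow_left₀ h0 h1 n).trans_eq ?_
    rw [← Real.exp_nat_mul, ht]
    congr 1; ring
  refine hchi.trans (le_trans ?_ ((sum_sum_exp_bitSign_le (ι := ι) t).trans ?_))
  · gcongr with σ _ σ' _
    exact hexp σ σ'
  · refine Real.exp_le_exp.2 ?_
    rw [← hm, le_div_iff₀ (by positivity), ht]
    have h1 : (2 * v * m) ^ 2 ≤ 1 := pow_le_one₀ (by positivity) hvm
    calc _ = (2 * v * m) ^ 2 * (a ^ 4 * n ^ 2) := by ring
      _ ≤ 1 * (a ^ 4 * n ^ 2) := by gcongr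
      _ = _ := one_mul _

end Perturbation


/-! ### A test for closeness of discrete distributions -/

section DiscreteTest

lemma measurePreserving_labels {X ι : Type*} [MeasurableSpace X] [MeasurableSpace ι] {f : X → ι}
    (hf : Measurable f) (q : Measure X) [IsProbabilityMeasure q] (n : ℕ) :
    MeasurePreserving (fun x : Fin (n + n) → X =>
      ((fun a => f (x (Fin.castAdd n a)), fun a => f (x (Fin.natAdd n a))) :
        (Fin n → ι) × (Fin n → ι)))
      (Measure.pi fun _ => q)
      ((Measure.pi fun _ : Fin n => q.map f).prod (Measure.pi fun _ : Fin n => q.map f)) := by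
  have := Measure.isProbabilityMeasure_map (μ := q) hf.aemeasurable
  have h1 := (measurePreserving_piCongrLeft (fun _ : Fin (n + n) => q)
    (finSumFinEquiv (m := n) (n := n))).symm
  have h2 := measurePreserving_sumPiEquivProdPi (fun _ : Fin n ⊕ Fin n => q)
  have h3 : MeasurePreserving (fun (x : Fin n → X) a => f (x a)) (Measure.pi fun _ => q)
      (Measure.pi fun _ => q.map f) :=
    ⟨measurable_pi_lambda _ fun a => hf.comp (measurable_pi_apply a),
      Measure.pi_map_pi fun _ => hf.aemeasurable⟩
  exact (h3.prod h3).comp (h2.comp h1)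

variable {ι : Type*} [Fintype ι]

/-- The sum of the values of `w` over a sample `x`, centred under the weights `p`. -/
def centeredSum (p w : ι → ℝ) {n : ℕ} (x : Fin n → ι) : ℝ :=
  ∑ a, (w (x a) - ∑ j, p j * w j)

/-- The inner product of the vectors of centred cell counts of two independent samples. It is an
unbiased estimator of `n ^ 2` times the squared `ℓ²`-distance from `p`. -/
def pairStat [DecidableEq ι] (p : ι → ℝ) {n : ℕ} (z : (Fin n → ι) × (Fin n → ι)) : ℝ :=
  centeredSum p (fun j => centeredSum p (Pi.single j 1) z.2) z.1

lemma sum_mul_centeredSum_single [DecidableEq ι] (p u : ι → ℝ) {n : ℕ} (y : Fin n → ι) :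
    ∑ j, u j * centeredSum p (Pi.single j 1) y = centeredSum p u y := by
  simp only [centeredSum, Finset.mul_sum]
  rw [Finset.sum_comm]
  refine Finset.sum_congr rfl fun a _ => ?_
  simp only [mul_sub, Finset.sum_sub_distrib]
  congr 1
  · simp [Pi.single_apply]
  · refine Finset.sum_congr rfl fun j _ => ?_
    simp [Pi.single_apply, mul_comm]

variable [MeasurableSpace ι] [MeasurableSingletonClass ι]

lemma integral_eq_sum_real (ν : Measure ι) [IsProbabilityMeasure ν] (w : ι → ℝ) :
    ∫ j, w j ∂ν = ∑ j, ν.real {j} * w j := by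
  rw [integral_fintype .of_finite]; rfl

lemma integral_centeredSum (p w : ι → ℝ) (ν : Measure ι) [IsProbabilityMeasure ν] (n : ℕ) :
    ∫ x, centeredSum p w x ∂(Measure.pi fun _ : Fin n => ν) =
      n * ∑ j, (ν.real {j} - p j) * w j := by
  simp only [centeredSum]
  rw [integral_finsetSum _ fun _ _ => .of_finite]
  have h : ∀ a : Fin n, ∫ x, (w (x a) - ∑ j, p j * w j) ∂(Measure.pi fun _ : Fin n => ν) =
      ∑ j, (ν.real {j} - p j) * w j := fun a => by
    rw [integral_sub .of_finite .of_finite, integral_const, probReal_univ, one_smul]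
    have h1 := integral_map (μ := Measure.pi fun _ : Fin n => ν)
      (measurable_pi_apply a).aemeasurable (f := w) .of_discrete
    rw [(measurePreserving_eval (fun _ : Fin n => ν) a).map_eq] at h1
    rw [← h1, integral_eq_sum_real, ← Finset.sum_sub_distrib]
    simp only [sub_mul]
  simp [h]

lemma integral_centeredSum_sq_le (p w : ι → ℝ) (ν : Measure ι) [IsProbabilityMeasure ν] (n : ℕ) :
    ∫ x, centeredSum p w x ^ 2 ∂(Measure.pi fun _ : Fin n => ν) ≤
      n * ∑ j, ν.real {j} * w j ^ 2 + n ^ 2 * (∑ j, (ν.real {j} - p j) * w j) ^ 2 := by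
  have h1 := ProbabilityTheory.variance_eq_sub (μ := Measure.pi fun _ : Fin n => ν)
    (X := fun x => centeredSum p w x) .of_discrete
  have h2 := ProbabilityTheory.variance_sum_pi (μ := fun _ : Fin n => ν)
    (X := fun _ j => w j - ∑ j, p j * w j) fun _ => .of_discrete
  have e : (∑ i : Fin n, fun x : Fin n → ι => w (x i) - ∑ j, p j * w j) =
      fun x => centeredSum p w x := by
    funext x; simp [centeredSum]
  have h3 : ProbabilityTheory.variance (fun j => w j - ∑ j, p j * w j) ν ≤
      ∑ j, ν.real {j} * w j ^ 2 := by
    rw [ProbabilityTheory.variance_sub_const .of_discrete,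
      ← integral_eq_sum_real ν fun j => w j ^ 2]
    exact ProbabilityTheory.variance_le_expectation_sq .of_discrete
  rw [e] at h2
  rw [h2, integral_centeredSum, Finset.sum_const, Finset.card_univ, Fintype.card_fin,
    nsmul_eq_mul] at h1
  simp only [Pi.pow_apply] at h1
  have h4 := mul_le_mul_of_nonneg_left h3 (Nat.cast_nonneg (α := ℝ) n)
  linarith

lemma integral_pairStat [DecidableEq ι] (p : ι → ℝ) (ν : Measure ι) [IsProbabilityMeasure ν]
    (n : ℕ) :
    ∫ z, pairStat p z ∂((Measure.pi fun _ : Fin n => ν).prod (Measure.pi fun _ : Fin n => ν)) =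
      n ^ 2 * ∑ j, (ν.real {j} - p j) ^ 2 := by
  rw [integral_prod_symm _ .of_finite]
  simp only [pairStat, integral_centeredSum, sum_mul_centeredSum_single]
  rw [integral_const_mul, integral_centeredSum]
  simp only [← sq]
  ring

/-- Second moment of `pairStat`, by conditioning on the second sample. -/
lemma integral_pairStat_sq_le [DecidableEq ι] (p : ι → ℝ) (ν : Measure ι) [IsProbabilityMeasure ν]
    (n : ℕ) :
    ∫ z, pairStat p z ^ 2 ∂((Measure.pi fun _ : Fin n => ν).prod (Measure.pi fun _ : Fin n => ν)) ≤
      (n ^ 2 * ∑ j, (ν.real {j} - p j) ^ 2) ^ 2 + n ^ 2 * ∑ j, ν.real {j} ^ 2 +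
        2 * n ^ 3 * ∑ j, ν.real {j} * (ν.real {j} - p j) ^ 2 := by
  rw [integral_prod_symm _ .of_finite]
  simp only [pairStat]
  have h1 : ∫ y, ∫ x, centeredSum p (fun j => centeredSum p (Pi.single j 1) y) x ^ 2
      ∂(Measure.pi fun _ : Fin n => ν) ∂(Measure.pi fun _ : Fin n => ν) ≤
      ∫ y, (n * ∑ j, ν.real {j} * centeredSum p (Pi.single j 1) y ^ 2 +
        n ^ 2 * centeredSum p (fun j => ν.real {j} - p j) y ^ 2)
        ∂(Measure.pi fun _ : Fin n => ν) := by
    refine integral_mono .of_finite .of_finite fun y => ?_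
    have := integral_centeredSum_sq_le p (fun j => centeredSum p (Pi.single j 1) y) ν n
    rwa [sum_mul_centeredSum_single] at this
  refine h1.trans ?_
  rw [integral_add .of_finite .of_finite, integral_const_mul, integral_const_mul,
    integral_finsetSum _ fun _ _ => .of_finite]
  simp only [integral_const_mul]
  have h2 : ∑ j, ν.real {j} * ∫ y, centeredSum p (Pi.single j 1) y ^ 2
      ∂(Measure.pi fun _ : Fin n => ν) ≤
      ∑ j, ν.real {j} * (n * ν.real {j} + n ^ 2 * (ν.real {j} - p j) ^ 2) := by
    refine Finset.sum_le_sum fun j _ => mul_le_mul_of_nonneg_left ?_ measureReal_nonneg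
    have := integral_centeredSum_sq_le p (Pi.single j 1) ν n
    simpa [Pi.single_apply] using this
  have h3 := integral_centeredSum_sq_le p (fun j => ν.real {j} - p j) ν n
  have h4 : ∑ j, ν.real {j} * (n * ν.real {j} + n ^ 2 * (ν.real {j} - p j) ^ 2) =
      n * ∑ j, ν.real {j} ^ 2 + n ^ 2 * ∑ j, ν.real {j} * (ν.real {j} - p j) ^ 2 := by
    rw [Finset.mul_sum, Finset.mul_sum, ← Finset.sum_add_distrib]
    exact Finset.sum_congr rfl fun j _ => by ring
  rw [h4] at h2
  simp only [← sq] at h3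
  have h5 := mul_le_mul_of_nonneg_left h2 (Nat.cast_nonneg (α := ℝ) n)
  have h6 := mul_le_mul_of_nonneg_left h3 (sq_nonneg (n : ℝ))
  nlinarith [h5, h6]

/-- A sample from `p` rarely has a large statistic. -/
lemma measureReal_le_pairStat [DecidableEq ι] {p : ι → ℝ} {ν : Measure ι} [IsProbabilityMeasure ν]
    (hp : ∀ j, ν.real {j} = p j) {b : ℝ} (hb : ∀ j, p j ≤ b) {n : ℕ} {θ : ℝ} (hθ : 0 ≤ θ) :
    ((Measure.pi fun _ : Fin n => ν).prod (Measure.pi fun _ : Fin n => ν)).real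
      {z | n ^ 2 * θ / 2 ≤ pairStat p z} * (n ^ 2 * θ) ^ 2 ≤ 4 * (n ^ 2 * b) := by
  set μ := (Measure.pi fun _ : Fin n => ν).prod (Measure.pi fun _ : Fin n => ν)
  have h1 := integral_pairStat_sq_le p ν n
  simp only [hp, sub_self, ne_eq, OfNat.ofNat_ne_zero, not_false_eq_true, zero_pow, mul_zero,
    Finset.sum_const_zero, add_zero, zero_add] at h1
  have h2 := mul_meas_ge_le_integral_of_nonneg (μ := μ) (f := fun z => pairStat p z ^ 2)
    (.of_forall fun z => sq_nonneg _) .of_finite ((n ^ 2 * θ / 2) ^ 2)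
  have h3 : μ.real {z | n ^ 2 * θ / 2 ≤ pairStat p z} ≤
      μ.real {z | (n ^ 2 * θ / 2) ^ 2 ≤ pairStat p z ^ 2} :=
    measureReal_mono fun z (hz : n ^ 2 * θ / 2 ≤ pairStat p z) =>
      pow_le_pow_left₀ (by positivity : 0 ≤ (n : ℝ) ^ 2 * θ / 2) hz 2
  have hsum : ∑ j, p j = 1 := by
    have := integral_eq_sum_real ν fun _ => (1 : ℝ)
    simp only [hp, mul_one, integral_const, probReal_univ, smul_eq_mul] at this
    exact this.symm
  have h4 : ∑ j, p j ^ 2 ≤ b := by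
    calc ∑ j, p j ^ 2 ≤ ∑ j, b * p j := Finset.sum_le_sum fun j _ => by
          rw [sq]; exact mul_le_mul_of_nonneg_right (hb j) (hp j ▸ measureReal_nonneg)
      _ = b := by rw [← Finset.mul_sum, hsum, mul_one]
  have h5 := mul_le_mul_of_nonneg_left h4 (sq_nonneg (n : ℝ))
  have h6 := mul_le_mul_of_nonneg_right h3 (sq_nonneg ((n : ℝ) ^ 2 * θ / 2))
  have h7 : ((n : ℝ) ^ 2 * θ / 2) ^ 2 = (n ^ 2 * θ) ^ 2 / 4 := by ring
  rw [h7] at h2 h6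
  linarith

/-- A sample from a distribution at squared `ℓ²`-distance at least `θ` from `p` usually has a large
statistic. -/
lemma measureReal_pairStat_lt [DecidableEq ι] {p : ι → ℝ} (hp0 : ∀ j, 0 ≤ p j)
    (hp1 : ∑ j, p j = 1) {b : ℝ} (hb : ∀ j, p j ≤ b) {ν : Measure ι} [IsProbabilityMeasure ν]
    {n : ℕ} {θ : ℝ} (hθ : 0 < θ) (hδ : θ ≤ ∑ j, (ν.real {j} - p j) ^ 2)
    (h1 : 100 ^ 2 * b ≤ (n * θ) ^ 2) (h2 : 100 ^ 2 ≤ n ^ 2 * θ) (h3 : 100 * b ≤ n * θ) :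
    ((Measure.pi fun _ : Fin n => ν).prod (Measure.pi fun _ : Fin n => ν)).real
      {z | pairStat p z < n ^ 2 * θ / 2} ≤ 1 / 3 := by
  set μ := (Measure.pi fun _ : Fin n => ν).prod (Measure.pi fun _ : Fin n => ν) with hμ
  set δ := ∑ j, (ν.real {j} - p j) ^ 2 with hδd
  have hδ0 : 0 < δ := hθ.trans_le hδ
  set s := √δ with hs
  have hs0 : 0 < s := Real.sqrt_pos.2 hδ0
  have hs2 : s ^ 2 = δ := Real.sq_sqrt hδ0.le
  have hn0 : (0 : ℝ) ≤ n := Nat.cast_nonneg n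
  have hb0 : 0 ≤ b := by
    by_contra hb'
    have : ∑ j, p j ≤ 0 := Finset.sum_nonpos fun j _ => (hb j).trans (not_le.1 hb').le
    linarith
  have hΔ : ∀ j, |ν.real {j} - p j| ≤ s := fun j => by
    refine Real.abs_le_sqrt ?_
    exact Finset.single_le_sum (f := fun j => (ν.real {j} - p j) ^ 2)
      (fun _ _ => sq_nonneg _) (Finset.mem_univ j)
  have hA : ∑ j, ν.real {j} ^ 2 ≤ 2 * b + 2 * δ := by
    calc ∑ j, ν.real {j} ^ 2 ≤ ∑ j, (2 * (b * p j) + 2 * (ν.real {j} - p j) ^ 2) := by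
          refine Finset.sum_le_sum fun j _ => ?_
          have := mul_le_mul_of_nonneg_right (hb j) (hp0 j)
          nlinarith [sq_nonneg (ν.real {j} - 2 * p j)]
      _ = _ := by
          rw [Finset.sum_add_distrib, ← Finset.mul_sum, ← Finset.mul_sum, ← Finset.mul_sum, hp1,
            mul_one]
  have hB : ∑ j, ν.real {j} * (ν.real {j} - p j) ^ 2 ≤ (b + s) * δ := by
    rw [hδd, Finset.mul_sum]
    refine Finset.sum_le_sum fun j _ => mul_le_mul_of_nonneg_right ?_ (sq_nonneg _)
    have := (abs_le.1 (hΔ j)).2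
    linarith [hb j]
  -- Chebyshev's inequality.
  have hvar : ∫ z, (pairStat p z - n ^ 2 * δ) ^ 2 ∂μ ≤
      n ^ 2 * (2 * b + 2 * δ) + 2 * n ^ 3 * ((b + s) * δ) := by
    have e : ∀ z : (Fin n → ι) × (Fin n → ι), (pairStat p z - n ^ 2 * δ) ^ 2 =
        pairStat p z ^ 2 - (2 * (n ^ 2 * δ)) * pairStat p z + (n ^ 2 * δ) ^ 2 := fun z => by ring
    simp_rw [e]
    rw [integral_add .of_finite .of_finite, integral_sub .of_finite .of_finite,
      integral_const_mul, integral_const, hμ, integral_pairStat, probReal_univ, one_smul]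
    have hm := integral_pairStat_sq_le p ν n
    have hA' := mul_le_mul_of_nonneg_left hA (sq_nonneg (n : ℝ))
    have hB' := mul_le_mul_of_nonneg_left hB (by positivity : (0 : ℝ) ≤ 2 * n ^ 3)
    rw [← hδd] at hm ⊢
    linarith
  have hcheb := mul_meas_ge_le_integral_of_nonneg (μ := μ)
    (f := fun z => (pairStat p z - n ^ 2 * δ) ^ 2) (.of_forall fun z => sq_nonneg _) .of_finite
    ((n ^ 2 * δ / 2) ^ 2)
  have hmono : μ.real {z | pairStat p z < n ^ 2 * θ / 2} ≤
      μ.real {z | (n ^ 2 * δ / 2) ^ 2 ≤ (pairStat p z - n ^ 2 * δ) ^ 2} := by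
    refine measureReal_mono fun z hz => ?_
    have hz' : pairStat p z < n ^ 2 * θ / 2 := hz
    have : (n : ℝ) ^ 2 * θ ≤ n ^ 2 * δ := by gcongr
    have h0 : 0 ≤ (n : ℝ) ^ 2 * δ := by positivity
    rw [Set.mem_ofPred_eq, ← neg_sq (pairStat p z - _)]
    exact pow_le_pow_left₀ (by positivity) (by linarith) 2
  -- Each term of the variance is a small fraction of `(n ^ 2 * δ) ^ 2`.
  set Y := (n : ℝ) ^ 2 * δ with hY
  have hY2 : 100 ^ 2 ≤ Y := h2.trans (by rw [hY]; gcongr)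
  have hY0 : 0 < Y := lt_of_lt_of_le (by norm_num) hY2
  have hns : 100 ≤ n * s := by
    refine (sq_le_sq₀ (by norm_num) (by positivity)).1 ?_
    rw [mul_pow, hs2]; exact hY2
  have t1 : 100 ^ 2 * (n ^ 2 * b) ≤ Y ^ 2 := by
    calc 100 ^ 2 * (n ^ 2 * b) = n ^ 2 * (100 ^ 2 * b) := by ring
      _ ≤ n ^ 2 * (n * δ) ^ 2 := by
          gcongr
          exact h1.trans (by gcongr)
      _ = Y ^ 2 := by rw [hY]; ring
  have t2 : 100 ^ 2 * Y ≤ Y ^ 2 := by rw [sq Y]; gcongr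
  have t3 : 100 * (n ^ 3 * (b * δ)) ≤ Y ^ 2 := by
    calc 100 * (n ^ 3 * (b * δ)) = n ^ 3 * δ * (100 * b) := by ring
      _ ≤ n ^ 3 * δ * (n * δ) :=
          mul_le_mul_of_nonneg_left (h3.trans (by gcongr)) (by positivity)
      _ = Y ^ 2 := by rw [hY]; ring
  have t4 : 100 * (n ^ 3 * (s * δ)) ≤ Y ^ 2 := by
    calc 100 * (n ^ 3 * (s * δ)) ≤ (n * s) * (n ^ 3 * (s * δ)) := by gcongr
      _ = n ^ 4 * s ^ 2 * δ := by ring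
      _ = Y ^ 2 := by rw [hY, hs2]; ring
  have hfin : (Y / 2) ^ 2 * μ.real {z | pairStat p z < n ^ 2 * θ / 2} ≤ (Y / 2) ^ 2 * (1 / 3) := by
    have := mul_le_mul_of_nonneg_left hmono (sq_nonneg (Y / 2))
    nlinarith
  exact le_of_mul_le_mul_left hfin (by positivity)

/-- The statistic `pairStat` of the labels of the two halves of a sample. -/
def levelStat {X : Type*} [DecidableEq ι] (f : X → ι) (p : ι → ℝ) {n : ℕ}
    (x : Fin (n + n) → X) : ℝ :=
  pairStat p (fun a => f (x (Fin.castAdd n a)), fun a => f (x (Fin.natAdd n a)))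

lemma measurable_levelStat {X : Type*} [MeasurableSpace X] [DecidableEq ι] {f : X → ι}
    (hf : Measurable f) (p : ι → ℝ) (n : ℕ) :
    Measurable fun x : Fin (n + n) → X => levelStat f p x := by
  have h : Measurable fun x : Fin (n + n) → X =>
      ((fun a => f (x (Fin.castAdd n a)), fun a => f (x (Fin.natAdd n a))) :
        (Fin n → ι) × (Fin n → ι)) :=
    (measurable_pi_lambda _ fun a => hf.comp (measurable_pi_apply _)).prodMk
      (measurable_pi_lambda _ fun a => hf.comp (measurable_pi_apply _))
  exact (Measurable.of_discrete (f := fun z : (Fin n → ι) × (Fin n → ι) => pairStat p z)).comp h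

lemma measureReal_levelStat {X : Type*} [MeasurableSpace X] [DecidableEq ι] {f : X → ι}
    (hf : Measurable f) (q : Measure X) [IsProbabilityMeasure q] (p : ι → ℝ) (n : ℕ) (A : Set ℝ) :
    (Measure.pi fun _ : Fin (n + n) => q).real {x | levelStat f p x ∈ A} =
      ((Measure.pi fun _ : Fin n => q.map f).prod (Measure.pi fun _ : Fin n => q.map f)).real
        {z | pairStat p z ∈ A} :=
  (measurePreserving_labels hf q n).measureReal_preimage
    (MeasurableSet.of_discrete (s := {z | pairStat p z ∈ A})).nullMeasurableSet

end DiscreteTest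


/-! ### The multiscale tester -/

section Tester

variable {X : Type*} [MeasurableSpace X]

/-- The deterministic tester with a given acceptance region. -/
noncomputable def Tester.ofSet {n : ℕ} (A : Set (Fin n → X)) (hA : MeasurableSet A) :
    Tester X n where
  acceptProb := A.indicator 1
  measurable_acceptProb := measurable_one.indicator hA
  acceptProb_le_one := fun x => Set.indicator_le_self' (fun _ _ => zero_le) x

lemma Tester.probAccepts_ofSet {n : ℕ} {A : Set (Fin n → X)} (hA : MeasurableSet A)
    (q : Measure X) :
    (Tester.ofSet A hA).probAccepts q = Measure.pi (fun _ : Fin n => q) A :=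
  lintegral_indicator_one hA

lemma Tester.probRejects_ofSet {n : ℕ} {A : Set (Fin n → X)} (hA : MeasurableSet A)
    (q : Measure X) :
    (Tester.ofSet A hA).probRejects q = Measure.pi (fun _ : Fin n => q) Aᶜ := by
  rw [← lintegral_indicator_one hA.compl]
  refine lintegral_congr fun x => ?_
  by_cases hx : x ∈ A <;> simp [Tester.ofSet, hx]

lemma two_thirds_le_of_measureReal_compl_le {Ω : Type*} [MeasurableSpace Ω] (μ : Measure Ω)
    [IsProbabilityMeasure μ] {A : Set Ω} (hA : MeasurableSet A) (h : μ.real Aᶜ ≤ 1 / 3) :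
    2 / 3 ≤ μ A := by
  rw [probReal_compl_eq_one_sub hA] at h
  have h2 : (2 / 3 : ℝ≥0∞) = ENNReal.ofReal (2 / 3) := by
    rw [ENNReal.ofReal_div_of_pos (by norm_num)]; simp
  rw [h2, ← ofReal_measureReal]
  exact ENNReal.ofReal_le_ofReal (by linarith)

/-- By the Cauchy–Schwarz inequality, closeness of the cell masses in `ℓ²` implies closeness in
`ℓ¹`. -/
lemma tsum_tsub_le_of_sum_sq_lt {ι : Type*} [Fintype ι] {f : X → ι} (p q : Measure X)
    [IsFiniteMeasure p] [IsFiniteMeasure q] {η : ℝ} (hη : 0 ≤ η)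
    (h : ∑ j, (q.real (f ⁻¹' {j}) - p.real (f ⁻¹' {j})) ^ 2 < η ^ 2 / Fintype.card ι) :
    ∑' c, (p (f ⁻¹' {c}) - q (f ⁻¹' {c})) ≤ ENNReal.ofReal η := by
  have hcard : (0 : ℝ) < Fintype.card ι := by
    by_contra hc
    have hz : (Fintype.card ι : ℝ) = 0 := le_antisymm (not_lt.1 hc) (Nat.cast_nonneg _)
    rw [hz, div_zero] at h
    exact absurd h (not_lt.2 (Finset.sum_nonneg fun _ _ => sq_nonneg _))
  rw [tsum_fintype]
  calc ∑ c, (p (f ⁻¹' {c}) - q (f ⁻¹' {c})) ≤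
      ∑ c, ENNReal.ofReal |q.real (f ⁻¹' {c}) - p.real (f ⁻¹' {c})| := by
        refine Finset.sum_le_sum fun c _ => ?_
        rw [← ofReal_measureReal, ← ofReal_measureReal (μ := q),
          ← ENNReal.ofReal_sub _ measureReal_nonneg]
        refine ENNReal.ofReal_le_ofReal ?_
        rw [abs_sub_comm]
        exact le_abs_self _
    _ = ENNReal.ofReal (∑ c, |q.real (f ⁻¹' {c}) - p.real (f ⁻¹' {c})|) :=
        (ENNReal.ofReal_sum_of_nonneg fun _ _ => abs_nonneg _).symm
    _ ≤ ENNReal.ofReal η := by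
        refine ENNReal.ofReal_le_ofReal (abs_le_of_sq_le_sq' ?_ hη).2
        have h1 := sq_sum_le_card_mul_sum_sq (s := Finset.univ)
          (f := fun c => |q.real (f ⁻¹' {c}) - p.real (f ⁻¹' {c})|)
        simp only [sq_abs, Finset.card_univ] at h1
        rw [lt_div_iff₀ hcard] at h
        linarith

/-- The multiscale tester: at each of the levels `1, …, L` of a hierarchy of partitions, the cell
masses are tested for closeness in `ℓ²`. If they are close at each level, then so are the
distributions in the Wasserstein distance. -/
theorem exists_tester_solves [MetricSpace X] (p : Measure X) [IsProbabilityMeasure p]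
    {ι : ℕ → Type*} [∀ i, Fintype (ι i)] [∀ i, DecidableEq (ι i)]
    [∀ i, MeasurableSpace (ι i)] [∀ i, MeasurableSingletonClass (ι i)] (f : ∀ i, X → ι i)
    (hf : ∀ i, Measurable (f i)) (h0 : ∀ x y, f 0 x = f 0 y)
    (hcoarse : ∀ i x y, f (i + 1) x = f (i + 1) y → f i x = f i y) (D : ℕ → ℝ)
    (hD0 : ∀ i, 0 ≤ D i) (hD : ∀ i x y, f i x = f i y → dist x y ≤ D i) (L : ℕ)
    {η b : ℕ → ℝ} (hη : ∀ i, 0 < η i) (hb : ∀ i j, p.real (f i ⁻¹' {j}) ≤ b i) {ε : ℝ}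
    (hε : D L + ∑ i ∈ Finset.range L, D i * η (i + 1) < ε) {n : ℕ} {θ : ℕ → ℝ}
    (hθ : ∀ i, θ i = η i ^ 2 / Fintype.card (ι i))
    (h1 : ∀ i < L, 100 ^ 2 * L * b (i + 1) ≤ (n * θ (i + 1)) ^ 2)
    (h2 : ∀ i < L, 100 ^ 2 ≤ n ^ 2 * θ (i + 1))
    (h3 : ∀ i < L, 100 * b (i + 1) ≤ n * θ (i + 1)) :
    ∃ T : Tester X (n + n), T.Solves p ε := by
  have hX : Nonempty X := by
    by_contra hX
    have := not_nonempty_iff.1 hX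
    have h := measure_univ (μ := p)
    rw [Measure.eq_zero_of_isEmpty p] at h
    simp at h
  have hι : ∀ i, Nonempty (ι i) := fun i => hX.map (f i)
  have hθ0 : ∀ i, 0 < θ i := fun i => by
    have := hι i
    have hc : (0 : ℝ) < Fintype.card (ι i) := by exact_mod_cast Fintype.card_pos
    have := hη i
    rw [hθ]; positivity
  have hreal : ∀ (q : Measure X) (i : ℕ) (j : ι i), (q.map (f i)).real {j} = q.real (f i ⁻¹' {j}) :=
    fun q i j => map_measureReal_apply (hf i) (measurableSet_singleton j)
  set P : ∀ i, ι i → ℝ := fun i j => p.real (f i ⁻¹' {j}) with hP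
  have hP1 : ∀ i, ∑ j, P i j = 1 := fun i => by
    have := Measure.isProbabilityMeasure_map (μ := p) (hf i).aemeasurable
    have := integral_eq_sum_real (p.map (f i)) fun _ => (1 : ℝ)
    simp only [hreal, mul_one, integral_const, probReal_univ, smul_eq_mul] at this
    exact this.symm
  set B : ℕ → Set (Fin (n + n) → X) := fun i =>
    {x | n ^ 2 * θ (i + 1) / 2 ≤ levelStat (f (i + 1)) (P (i + 1)) x} with hB
  have hBm : ∀ i, MeasurableSet (B i) := fun i =>
    measurableSet_le measurable_const (measurable_levelStat (hf _) _ _)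
  set R : Set (Fin (n + n) → X) := ⋃ i ∈ Finset.range L, B i with hR
  have hRm : MeasurableSet R := Finset.measurableSet_biUnion _ fun i _ => hBm i
  refine ⟨Tester.ofSet Rᶜ hRm.compl, fun q hq => ⟨?_, ?_⟩⟩
  · rintro rfl
    rw [Tester.probAccepts_ofSet]
    refine two_thirds_le_of_measureReal_compl_le _ hRm.compl ?_
    rw [compl_compl]
    rcases Nat.eq_zero_or_pos L with hL | hL
    · rw [hR, hL]
      simp
    have hL' : (0 : ℝ) < L := by exact_mod_cast hL
    have hBi : ∀ i ∈ Finset.range L,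
        (Measure.pi fun _ : Fin (n + n) => p).real (B i) ≤ 1 / (3 * L) := fun i hi => by
      have hi := Finset.mem_range.1 hi
      have := Measure.isProbabilityMeasure_map (μ := p) (hf (i + 1)).aemeasurable
      have key := measureReal_le_pairStat (ν := p.map (f (i + 1))) (p := P (i + 1))
        (fun j => hreal p _ j) (fun j => hb _ j) (n := n) (hθ0 (i + 1)).le
      have e := measureReal_levelStat (hf (i + 1)) p (P (i + 1)) n
        (Set.Ici (n ^ 2 * θ (i + 1) / 2))
      simp only [Set.mem_Ici] at e
      rw [← e] at key
      change (Measure.pi fun _ : Fin (n + n) => p).real (B i) * _ ≤ _ at key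
      have hn : (0 : ℝ) < n := by
        rcases Nat.eq_zero_or_pos n with h | h
        · have := h2 i hi
          rw [h] at this
          norm_num at this
        · exact_mod_cast h
      have hpos : 0 < (n ^ 2 * θ (i + 1)) ^ 2 := by
        have := hθ0 (i + 1)
        positivity
      refine le_of_mul_le_mul_right (key.trans ?_) hpos
      have hb0 : 0 ≤ b (i + 1) :=
        measureReal_nonneg.trans (hb (i + 1) (Classical.arbitrary _))
      rw [one_div, ← div_eq_inv_mul, le_div_iff₀ (by positivity)]
      calc 4 * (n ^ 2 * b (i + 1)) * (3 * L) = 12 * L * b (i + 1) * n ^ 2 := by ring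
        _ ≤ 100 ^ 2 * L * b (i + 1) * n ^ 2 := by gcongr; norm_num
        _ ≤ (n * θ (i + 1)) ^ 2 * n ^ 2 := by gcongr; exact h1 i hi
        _ = _ := by ring
    calc (Measure.pi fun _ : Fin (n + n) => p).real R ≤
          ∑ i ∈ Finset.range L, (Measure.pi fun _ : Fin (n + n) => p).real (B i) :=
          measureReal_biUnion_finset_le _ _
      _ ≤ ∑ i ∈ Finset.range L, 1 / (3 * (L : ℝ)) := Finset.sum_le_sum hBi
      _ = 1 / 3 := by
          rw [Finset.sum_const, Finset.card_range, nsmul_eq_mul]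
          field_simp
  · intro hW
    rw [Tester.probRejects_ofSet, compl_compl]
    -- Some level sees the difference, for otherwise the hierarchical coupling is too cheap.
    have hex : ∃ i < L, θ (i + 1) ≤ ∑ j, (q.real (f (i + 1) ⁻¹' {j}) - P (i + 1) j) ^ 2 := by
      by_contra! hcon
      obtain ⟨M, hM, hMc⟩ := exists_coupling_lintegral_edist_le f hf h0 hcoarse
        (fun i => ENNReal.ofReal (D i))
        (fun i x y hxy => by rw [edist_dist]; exact ENNReal.ofReal_le_ofReal (hD i x y hxy))
        L p q (by rw [measure_univ, measure_univ])
      have h4 : ENNReal.ofReal ε ≤ ∫⁻ z, edist z.1 z.2 ∂M := hW.trans (iInf₂_le M hM)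
      have h5 : ENNReal.ofReal (D L) * p Set.univ +
          ∑ i ∈ Finset.range L, ENNReal.ofReal (D i) *
            ∑' c, (p (f (i + 1) ⁻¹' {c}) - q (f (i + 1) ⁻¹' {c})) ≤
          ENNReal.ofReal (D L + ∑ i ∈ Finset.range L, D i * η (i + 1)) := by
        rw [measure_univ, mul_one, ENNReal.ofReal_add (hD0 L)
          (Finset.sum_nonneg fun i _ => mul_nonneg (hD0 i) (hη _).le),
          ENNReal.ofReal_sum_of_nonneg fun i _ => mul_nonneg (hD0 i) (hη _).le]
        refine add_le_add le_rfl (Finset.sum_le_sum fun i hi => ?_)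
        rw [ENNReal.ofReal_mul (hD0 i)]
        gcongr
        refine tsum_tsub_le_of_sum_sq_lt p q (hη _).le ?_
        rw [← hθ]
        exact hcon i (Finset.mem_range.1 hi)
      have h6 := (h4.trans hMc).trans h5
      rw [ENNReal.ofReal_le_ofReal_iff'] at h6
      have h7 : 0 ≤ D L + ∑ i ∈ Finset.range L, D i * η (i + 1) :=
        add_nonneg (hD0 L) (Finset.sum_nonneg fun i _ => mul_nonneg (hD0 i) (hη _).le)
      rcases h6 with h6 | h6 <;> linarith
    obtain ⟨i, hi, hθi⟩ := hex
    have hL : (1 : ℝ) ≤ L := by exact_mod_cast Nat.one_le_of_lt hi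
    have hb0 : 0 ≤ b (i + 1) :=
      measureReal_nonneg.trans (hb (i + 1) (Classical.arbitrary _))
    have := Measure.isProbabilityMeasure_map (μ := q) (hf (i + 1)).aemeasurable
    have key := measureReal_pairStat_lt (ν := q.map (f (i + 1))) (p := P (i + 1))
      (fun j => measureReal_nonneg) (hP1 (i + 1)) (hb (i + 1)) (n := n) (hθ0 (i + 1))
      (by simpa only [hreal] using hθi)
      (le_trans (by
        have := mul_le_mul_of_nonneg_right hL hb0
        linarith) (h1 i hi)) (h2 i hi) (h3 i hi)
    have e := measureReal_levelStat (hf (i + 1)) q (P (i + 1)) n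
      (Set.Iio (n ^ 2 * θ (i + 1) / 2))
    simp only [Set.mem_Iio] at e
    rw [← e] at key
    refine (two_thirds_le_of_measureReal_compl_le _ (hBm i) ?_).trans
      (measure_mono (Set.subset_biUnion_of_mem (u := B) (Finset.mem_coe.2 (Finset.mem_range.2 hi))))
    refine le_trans (measureReal_mono ?_) key
    intro x (hx : ¬ n ^ 2 * θ (i + 1) / 2 ≤ levelStat (f (i + 1)) (P (i + 1)) x)
    exact not_le.1 hx

end Tester


/-! ### Boxes and the uniform distribution -/

section Boxes

variable {d : ℕ}

lemma volume_box (s : Fin d → Set ℝ) :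
    volume {x : EuclideanSpace ℝ (Fin d) | ∀ i, x i ∈ s i} = ∏ i, volume (s i) := by
  have h := (PiLp.volume_preserving_ofLp (Fin d)).measure_preimage_emb
    (MeasurableEquiv.toLp 2 (Fin d → ℝ)).symm.measurableEmbedding (Set.univ.pi s)
  rw [volume_pi_pi] at h
  rw [← h]
  congr 1
  ext x
  simp

lemma measurableSet_box {s : Fin d → Set ℝ} (hs : ∀ i, MeasurableSet (s i)) :
    MeasurableSet {x : EuclideanSpace ℝ (Fin d) | ∀ i, x i ∈ s i} := by
  have : {x : EuclideanSpace ℝ (Fin d) | ∀ i, x i ∈ s i} = ⋂ i, (fun x => x i) ⁻¹' s i := by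
    ext x; simp
  rw [this]
  refine MeasurableSet.iInter fun i => ?_
  have hm : Measurable fun x : EuclideanSpace ℝ (Fin d) => x i := by fun_prop
  exact hm (hs i)

lemma abs_apply_sub_le_dist (x y : EuclideanSpace ℝ (Fin d)) (i : Fin d) :
    |x i - y i| ≤ dist x y := by
  rw [dist_eq_norm, ← Real.norm_eq_abs, ← PiLp.sub_apply]
  exact PiLp.norm_apply_le (x - y) i

lemma dist_le_of_forall_abs_le {x y : EuclideanSpace ℝ (Fin d)} {δ : ℝ} (hδ : 0 ≤ δ)
    (h : ∀ i, |x i - y i| ≤ δ) : dist x y ≤ d * δ := by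
  rw [EuclideanSpace.dist_eq]
  refine Real.sqrt_le_iff.2 ⟨by positivity, ?_⟩
  calc ∑ i, dist (x i) (y i) ^ 2 ≤ ∑ _i : Fin d, δ ^ 2 :=
        Finset.sum_le_sum fun i _ => pow_le_pow_left₀ dist_nonneg (h i) 2
    _ = d * δ ^ 2 := by simp
    _ ≤ d ^ 2 * δ ^ 2 := by
        gcongr
        rw [sq]
        exact_mod_cast Nat.le_mul_self d
    _ = (d * δ) ^ 2 := by ring

lemma uniform_real_preimage {S : Set (EuclideanSpace ℝ (Fin d))} (hS : MeasurableSet S)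
    (A : Set (EuclideanSpace ℝ (Fin d))) :
    (uniform S).real (Subtype.val ⁻¹' A) = volume.real (S ∩ A) / volume.real S := by
  rw [uniform, measureReal_ennreal_smul_apply, ENNReal.toReal_inv, measureReal_def,
    comap_subtype_coe_apply hS, Subtype.image_preimage_coe, inv_mul_eq_div]
  rfl

/-- A measurable set between the cubes `[0, 1 / d]^d` and `[-1, 1]^d`. Both the unit cube and the
unit ball are of this form. -/
structure IsFat (S : Set (EuclideanSpace ℝ (Fin d))) : Prop where
  measurableSet : MeasurableSet S
  small_cube_subset : {x : EuclideanSpace ℝ (Fin d) | ∀ i, x i ∈ Set.Icc (0 : ℝ) (1 / d)} ⊆ S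
  subset_big_cube : ∀ x ∈ S, ∀ i, x i ∈ Set.Icc (-1 : ℝ) 1

lemma isFat_cube (hd : 1 ≤ d) : IsFat (cube d) where
  measurableSet := measurableSet_box fun _ => measurableSet_Icc
  small_cube_subset := fun x hx i =>
    ⟨(hx i).1, (hx i).2.trans (div_le_one_of_le₀ (by exact_mod_cast hd) (by positivity))⟩
  subset_big_cube := fun x hx i => ⟨by linarith [(hx i).1], (hx i).2⟩

lemma isFat_unitBall (hd : 1 ≤ d) : IsFat (unitBall d) where
  measurableSet := Metric.isClosed_closedBall.measurableSet
  small_cube_subset := fun x hx => by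
    rw [unitBall, Metric.mem_closedBall]
    have hd' : (d : ℝ) ≠ 0 := by positivity
    refine (dist_le_of_forall_abs_le (δ := 1 / d) (by positivity) fun i => ?_).trans_eq ?_
    · rw [PiLp.zero_apply, sub_zero, abs_of_nonneg (hx i).1]
      exact (hx i).2
    · field_simp
  subset_big_cube := fun x hx i => by
    rw [unitBall, Metric.mem_closedBall] at hx
    have := (abs_apply_sub_le_dist x 0 i).trans hx
    rw [PiLp.zero_apply, sub_zero] at this
    exact abs_le.1 this

variable {S : Set (EuclideanSpace ℝ (Fin d))}

lemma IsFat.volume_ne_top (hS : IsFat S) : volume S ≠ ∞ := by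
  have hsub : S ⊆ {x | ∀ i, x i ∈ Set.Icc (-1 : ℝ) 1} := hS.subset_big_cube
  refine ((measure_mono hsub).trans_lt ?_).ne
  rw [volume_box]
  simp

lemma IsFat.volume_real_pos (hS : IsFat S) (hd : 1 ≤ d) : 0 < volume.real S := by
  refine ENNReal.toReal_pos (ne_of_gt ?_) hS.volume_ne_top
  refine lt_of_lt_of_le ?_ (measure_mono hS.small_cube_subset)
  rw [volume_box, pos_iff_ne_zero, Finset.prod_ne_zero_iff]
  intro i _
  rw [Real.volume_Icc, sub_zero]
  simp only [one_div, ne_eq, ENNReal.ofReal_eq_zero, not_le]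
  positivity

lemma IsFat.isProbabilityMeasure_uniform (hS : IsFat S) (hd : 1 ≤ d) :
    IsProbabilityMeasure (uniform S) := by
  constructor
  rw [uniform, Measure.smul_apply, comap_subtype_coe_apply hS.measurableSet, Set.image_univ,
    Subtype.range_coe, smul_eq_mul]
  exact ENNReal.inv_mul_cancel
    (fun h => (hS.volume_real_pos hd).ne' (by rw [measureReal_def, h, ENNReal.toReal_zero]))
    hS.volume_ne_top

lemma volume_real_box {s : Fin d → Set ℝ} {t : ℝ} (ht : 0 ≤ t)
    (hs : ∀ i, volume (s i) = ENNReal.ofReal t) :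
    volume.real {x : EuclideanSpace ℝ (Fin d) | ∀ i, x i ∈ s i} = t ^ d := by
  rw [measureReal_def, volume_box]
  simp [hs, ht]

end Boxes

/-! ### Few samples do not suffice -/

section Lower

variable {d : ℕ} {S : Set (EuclideanSpace ℝ (Fin d))}

/-- The lower corner of the cell with index `(c, b)` among `2 K ^ d` disjoint cubes with sides of
length `1 / (2 d K)`: the cubes with `b = false` tile `[0, 1 / (2 d)]^d`, and those with `b = true`
are their translates by the vector with all coordinates equal to `1 / (2 d)`. -/
noncomputable def corner (d K : ℕ) (j : (Fin d → Fin K) × Bool) (i : Fin d) : ℝ :=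
  1 / (2 * d * K) * (j.1 i : ℕ) + if j.2 then (1 / (2 * d) : ℝ) else 0

lemma corner_nonneg (d K : ℕ) (j : (Fin d → Fin K) × Bool) (i : Fin d) : 0 ≤ corner d K j i := by
  unfold corner
  split_ifs <;> positivity

lemma corner_false_add_le (hd : 1 ≤ d) {K : ℕ} (hK : 1 ≤ K) (c : Fin d → Fin K) (i : Fin d) :
    1 / (2 * d * K) * ((c i : ℕ) : ℝ) + 1 / (2 * d * K) ≤ 1 / (2 * d) := by
  have h : ((c i : ℕ) : ℝ) + 1 ≤ K := by exact_mod_cast (c i).2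
  have hd' : (0 : ℝ) < d := by exact_mod_cast hd
  have hK' : (0 : ℝ) < K := by exact_mod_cast hK
  calc _ = 1 / (2 * d * K) * (((c i : ℕ) : ℝ) + 1) := by ring
    _ ≤ 1 / (2 * d * K) * K := by gcongr
    _ = _ := by field_simp

/-- A tester with `n` samples for a fat set satisfies the lower bounds that come from perturbing the
uniform distribution by a factor `1 ± a` on cells of size about `1 / K`. -/
theorem pow_le_of_solves (hS : IsFat S) (hd : 1 ≤ d) {K : ℕ} (hK : 1 ≤ K) {a ε : ℝ} (ha0 : 0 ≤ a)
    (ha1 : a ≤ 1) (hε : ε ≤ a * (1 / (8 * d * (4 * d) ^ d * volume.real S)) / K) {n : ℕ}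
    (T : Tester S n) (hT : T.Solves (uniform S) ε) : (K : ℝ) ^ d ≤ 5 * (a ^ 4 * n ^ 2) := by
  have hd' : (0 : ℝ) < d := by exact_mod_cast hd
  have hK' : (0 : ℝ) < K := by exact_mod_cast hK
  have hvol := hS.volume_real_pos hd
  have := hS.isProbabilityMeasure_uniform hd
  set s : ℝ := 1 / (2 * d * K) with hs
  have hs0 : 0 < s := by positivity
  have hne : Nonempty (Fin d → Fin K) := ⟨fun _ => ⟨0, hK⟩⟩
  set U' : (Fin d → Fin K) × Bool → Set (EuclideanSpace ℝ (Fin d)) := fun j =>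
    {x | ∀ i, x i ∈ Set.Ioo (corner d K j i) (corner d K j i + s)} with hU'
  set V' : (Fin d → Fin K) × Bool → Set (EuclideanSpace ℝ (Fin d)) := fun j =>
    {x | ∀ i, x i ∈ Set.Icc (corner d K j i + s / 4) (corner d K j i + 3 * s / 4)} with hV'
  have hcorner : ∀ j i, corner d K j i + s ≤ 1 / d := fun j i => by
    have h := corner_false_add_le hd hK j.1 i
    have h2 : (1 : ℝ) / d = 1 / (2 * d) + 1 / (2 * d) := by field_simp; norm_num
    have h3 : (0 : ℝ) ≤ 1 / (2 * d) := by positivity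
    unfold corner
    split_ifs <;> linarith
  have hUS : ∀ j, U' j ⊆ S := fun j x hx => hS.small_cube_subset fun i =>
    ⟨(corner_nonneg d K j i).trans (hx i).1.le, (hx i).2.le.trans (hcorner j i)⟩
  have hVU : ∀ j, V' j ⊆ U' j := fun j x hx i => by
    have := hx i
    exact ⟨by linarith [this.1], by linarith [this.2]⟩
  have hdisj : Pairwise fun j j' => Disjoint (U' j) (U' j') := by
    rintro ⟨c, b⟩ ⟨c', b'⟩ hne
    refine Set.disjoint_left.2 fun x hx hx' => hne ?_
    -- The intersection of two cells is empty as soon as one of their projections is.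
    have hbb : b = b' := by
      have h1 := hx ⟨0, hd⟩
      have h2 := hx' ⟨0, hd⟩
      have h3 := corner_false_add_le hd hK c ⟨0, hd⟩
      have h4 := corner_false_add_le hd hK c' ⟨0, hd⟩
      have h5 := corner_nonneg d K (c, false) ⟨0, hd⟩
      have h6 := corner_nonneg d K (c', false) ⟨0, hd⟩
      simp only [corner, Set.mem_Ioo, Bool.false_eq_true, if_false, add_zero] at h1 h2 h5 h6
      cases b <;> cases b' <;> simp only [Bool.false_eq_true, if_false, if_true, add_zero] at h1 h2
      · rfl
      · linarith [h1.2, h2.1]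
      · linarith [h1.1, h2.2]
      · rfl
    subst hbb
    congr 1
    funext i
    have h1 := hx i
    have h2 := hx' i
    simp only [corner, Set.mem_Ioo, ← hs] at h1 h2
    have hlt : ∀ k l : ℕ, s * k < s * l + s → k ≤ l := fun k l h => by
      have : (k : ℝ) < l + 1 := by
        refine lt_of_mul_lt_mul_left (a := s) ?_ hs0.le
        linarith
      exact Nat.lt_succ_iff.1 (by exact_mod_cast this)
    exact Fin.ext (le_antisymm (hlt _ _ (by linarith [h1.1, h2.2]))
      (hlt _ _ (by linarith [h1.2, h2.1])))
  have hUvol : ∀ j, volume.real (U' j) = s ^ d := fun j =>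
    volume_real_box hs0.le fun i => by rw [Real.volume_Ioo, add_sub_cancel_left]
  have hVvol : ∀ j, volume.real (V' j) = (s / 2) ^ d := fun j =>
    volume_real_box (by positivity) fun i => by
      rw [Real.volume_Icc]; congr 1; ring
  have key := ten_ninths_le_exp_of_solves (uniform S) (U := fun j => Subtype.val ⁻¹' U' j)
    (V := fun j => Subtype.val ⁻¹' V' j) (fun j j' h => (hdisj h).preimage _)
    (fun j => measurable_subtype_coe (measurableSet_box fun _ => measurableSet_Ioo))
    (v := s ^ d / volume.real S) (fun j => by
      rw [uniform_real_preimage hS.measurableSet, Set.inter_eq_right.2 (hUS j), hUvol])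
    (r := s / 4) (β := (s / 2) ^ d / volume.real S) (by positivity) (by positivity)
    (fun j => by
      rw [uniform_real_preimage hS.measurableSet,
        Set.inter_eq_right.2 ((hVU j).trans (hUS j)), hVvol])
    (fun j x hx y hy => by
      by_contra! hlt
      refine hy fun i => ?_
      have h1 := hx i
      have h2 := abs_lt.1 ((abs_apply_sub_le_dist y.1 x.1 i).trans_lt hlt)
      exact ⟨by linarith [h1.1, h2.1], by linarith [h1.2, h2.2]⟩)
    ha0 ha1 (ε := ε) (hε.trans_eq (by
      have hKs : (K : ℝ) * s = 1 / (2 * d) := by rw [hs]; field_simp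
      have hcard : (Fintype.card (Fin d → Fin K) : ℝ) = (K : ℝ) ^ d := by simp
      rw [hcard]
      have h1 : (K : ℝ) ^ d * (s / 2) ^ d = 1 / (4 * d) ^ d := by
        rw [← mul_pow, ← mul_div_assoc, hKs, div_div, div_pow, one_pow]
        congr 2; ring
      calc _ = a * (1 / (8 * d * K)) * (1 / (4 * d) ^ d) / volume.real S := by
            field_simp
        _ = a * (s / 4) * ((K : ℝ) ^ d * (s / 2) ^ d) / volume.real S := by
            rw [h1, hs]; congr 3; field_simp; norm_num
        _ = _ := by ring)) T hT
  simp only [Fintype.card_fun, Fintype.card_fin, Nat.cast_pow] at key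
  -- `exp (1 / 10) < 10 / 9`
  have hexp : Real.exp (1 / 10) ≤ 10 / 9 := by
    have := Real.exp_bound_div_one_sub_of_interval (x := 1 / 10) (by norm_num) (by norm_num)
    norm_num at this ⊢
    exact this
  have h1 := Real.exp_le_exp.1 (hexp.trans key)
  rw [le_div_iff₀ (by positivity)] at h1
  linarith

end Lower


/-! ### Dyadic partitions -/

section Dyadic

variable {d : ℕ} {S : Set (EuclideanSpace ℝ (Fin d))}

lemma IsFat.floor_lt (hS : IsFat S) (i : ℕ) (x : S) (k : Fin d) :
    ⌊(2 : ℝ) ^ i * ((x.1 k + 1) / 3)⌋₊ < 2 ^ i := by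
  have h := hS.subset_big_cube x.1 x.2 k
  rw [Nat.floor_lt (mul_nonneg (by positivity) (by linarith [h.1])), Nat.cast_pow, Nat.cast_ofNat]
  exact mul_lt_of_lt_one_right (by positivity) (by linarith [h.2])

/-- The label of a point of a fat set in the partition of `[-1, 2)^d` into `2 ^ (i d)` cubes with
sides of length `3 / 2 ^ i`. The cube `[-1, 2)^d` instead of `[-1, 1]^d` leaves no boundary points
outside the half-open cells. -/
noncomputable def IsFat.label (hS : IsFat S) (i : ℕ) (x : S) : Fin d → Fin (2 ^ i) := fun k =>
  ⟨⌊(2 : ℝ) ^ i * ((x.1 k + 1) / 3)⌋₊, hS.floor_lt i x k⟩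

lemma IsFat.measurable_label (hS : IsFat S) (i : ℕ) : Measurable (hS.label i) := by
  refine measurable_pi_lambda _ fun k => measurable_to_countable' fun j => ?_
  have hm : Measurable fun x : S => ⌊(2 : ℝ) ^ i * ((x.1 k + 1) / 3)⌋₊ := by
    refine Nat.measurable_floor.comp ?_
    have : Measurable fun x : EuclideanSpace ℝ (Fin d) => x k := by fun_prop
    exact (((this.comp measurable_subtype_coe).add_const 1).div_const 3).const_mul _
  have : (fun x => hS.label i x k) ⁻¹' {j} =
      (fun x : S => ⌊(2 : ℝ) ^ i * ((x.1 k + 1) / 3)⌋₊) ⁻¹' {(j : ℕ)} := by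
    ext x
    simp [IsFat.label, Fin.ext_iff]
  rw [this]
  exact hm (measurableSet_singleton _)

lemma IsFat.label_zero (hS : IsFat S) (x y : S) : hS.label 0 x = hS.label 0 y := by
  funext k
  exact Fin.ext (by have := (hS.label 0 x k).2; have := (hS.label 0 y k).2; omega)

lemma IsFat.label_coarse (hS : IsFat S) (i : ℕ) (x y : S)
    (h : hS.label (i + 1) x = hS.label (i + 1) y) : hS.label i x = hS.label i y := by
  have e : ∀ (x : S) k, ((hS.label i x k : Fin _) : ℕ) = (hS.label (i + 1) x k : ℕ) / 2 :=
    fun x k => by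
    have h := Nat.floor_div_natCast ((2 : ℝ) ^ (i + 1) * ((x.1 k + 1) / 3)) 2
    simp only [IsFat.label]
    rw [← h]
    congr 1
    rw [pow_succ, Nat.cast_ofNat]
    ring
  funext k
  exact Fin.ext (by rw [e, e, h])

lemma IsFat.label_eq_mem (hS : IsFat S) (i : ℕ) (x : S) (k : Fin d) :
    x.1 k ∈ Set.Ico (3 / 2 ^ i * ((hS.label i x k : ℕ) : ℝ) - 1)
      (3 / 2 ^ i * ((hS.label i x k : ℕ) : ℝ) - 1 + 3 / 2 ^ i) := by
  have h := hS.subset_big_cube x.1 x.2 k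
  have hp : (0 : ℝ) < 2 ^ i := by positivity
  have h1 := Nat.floor_le (mul_nonneg hp.le
    (by linarith [h.1] : (0 : ℝ) ≤ (x.1 k + 1) / 3))
  have h2 := Nat.lt_floor_add_one ((2 : ℝ) ^ i * ((x.1 k + 1) / 3))
  change ((hS.label i x k : ℕ) : ℝ) ≤ _ at h1
  change _ < ((hS.label i x k : ℕ) : ℝ) + 1 at h2
  have e : x.1 k + 1 = 3 / 2 ^ i * (2 ^ i * ((x.1 k + 1) / 3)) := by field_simp
  have hq : (0 : ℝ) < 3 / 2 ^ i := by positivity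
  constructor
  · have := mul_le_mul_of_nonneg_left h1 hq.le
    linarith
  · have := mul_lt_mul_of_pos_left h2 hq
    linarith

lemma IsFat.dist_le_of_label_eq (hS : IsFat S) (i : ℕ) (x y : S)
    (h : hS.label i x = hS.label i y) : dist x y ≤ 3 * d / 2 ^ i := by
  have := dist_le_of_forall_abs_le (x := x.1) (y := y.1) (δ := 3 / 2 ^ i) (by positivity)
    fun k => by
      have h1 := hS.label_eq_mem i x k
      have h2 := hS.label_eq_mem i y k
      rw [h] at h1
      rw [abs_le]
      constructor <;> linarith [h1.1, h1.2, h2.1, h2.2]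
  calc dist x y ≤ d * (3 / 2 ^ i) := this
    _ = _ := by ring

lemma IsFat.uniform_real_label_le (hS : IsFat S) (hd : 1 ≤ d) (i : ℕ) (j : Fin d → Fin (2 ^ i)) :
    (uniform S).real (hS.label i ⁻¹' {j}) ≤ 3 ^ d / volume.real S / (2 ^ i) ^ d := by
  set A : Set (EuclideanSpace ℝ (Fin d)) := {x | ∀ k, x k ∈
    Set.Ico (3 / 2 ^ i * ((j k : ℕ) : ℝ) - 1) (3 / 2 ^ i * ((j k : ℕ) : ℝ) - 1 + 3 / 2 ^ i)}
  have hvol : volume.real A = (3 / 2 ^ i) ^ d := volume_real_box (by positivity) fun k => by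
    rw [Real.volume_Ico, add_sub_cancel_left]
  have hA : volume A ≠ ∞ := by
    rw [volume_box]
    exact ENNReal.prod_ne_top fun k _ => by simp [Real.volume_Ico]
  have hsub : hS.label i ⁻¹' {j} ⊆ Subtype.val ⁻¹' A := by
    rintro x rfl k
    exact hS.label_eq_mem i x k
  have := hS.isProbabilityMeasure_uniform hd
  calc (uniform S).real (hS.label i ⁻¹' {j}) ≤ (uniform S).real (Subtype.val ⁻¹' A) :=
        measureReal_mono hsub
    _ = volume.real (S ∩ A) / volume.real S := uniform_real_preimage hS.measurableSet A
    _ ≤ volume.real A / volume.real S := by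
        gcongr
        exact Set.inter_subset_right
    _ = _ := by rw [hvol, div_pow]; ring

end Dyadic

/-! ### Rates -/

section Rates

/-- The rate `ε ^ (- max 2 (d / 2))` is the square root of `ε ^ (- max 4 d)`. -/
lemma rate_sq (d : ℕ) {ε : ℝ} (hε : 0 < ε) :
    (ε ^ (-max (2 : ℝ) ((d : ℝ) / 2))) ^ 2 = (ε ^ max 4 d)⁻¹ := by
  rw [← Real.rpow_natCast (ε ^ _) 2, ← Real.rpow_mul hε.le, ← Real.rpow_natCast ε,
    ← Real.rpow_neg hε.le]
  congr 1
  push_cast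
  rw [neg_mul, max_mul_of_nonneg _ _ (by norm_num)]
  norm_num

lemma one_le_rate (d : ℕ) {ε : ℝ} (hε : 0 < ε) (hε1 : ε ≤ 1) :
    1 ≤ ε ^ (-max (2 : ℝ) ((d : ℝ) / 2)) :=
  Real.one_le_rpow_of_pos_of_le_one_of_nonpos hε hε1
    (neg_nonpos.2 (le_max_of_le_left (by norm_num)))

/-- The cost of testing at scale `1 / u` is largest at the coarsest or at the finest scale,
according to whether `d ≤ 4` or not. -/
lemma pow_div_pow_le_rate {d : ℕ} {u ε A : ℝ} (hu : 1 ≤ u) (hε : 0 < ε) (hA : 1 ≤ A)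
    (huA : u * ε ≤ A) : u ^ d / (u * ε) ^ 4 ≤ A ^ max 4 d * (ε ^ max 4 d)⁻¹ := by
  have hu0 : 0 < u := zero_lt_one.trans_le hu
  obtain ⟨l, hl⟩ : ∃ l, max 4 d = 4 + l := ⟨max 4 d - 4, by omega⟩
  calc u ^ d / (u * ε) ^ 4 ≤ u ^ (max 4 d) / (u * ε) ^ 4 := by
        gcongr
        exact le_max_right _ _
    _ = (u * ε) ^ l * (ε ^ max 4 d)⁻¹ := by
        rw [hl, pow_add, pow_add, mul_pow, mul_pow]
        field_simp
    _ ≤ A ^ max 4 d * (ε ^ max 4 d)⁻¹ := by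
        gcongr
        calc (u * ε) ^ l ≤ A ^ l := by gcongr
          _ ≤ A ^ max 4 d := pow_le_pow_right₀ hA (by omega)

end Rates

/-! ### Sample complexity of fat sets -/

section Complexity

variable {d : ℕ} {S : Set (EuclideanSpace ℝ (Fin d))}

/-- `C * L ^ 3 * ε ^ (- max 2 (d / 2))` samples in each half suffice for the multiscale tester with
`L` dyadic scales, the finest of which is of order `ε`. -/
lemma IsFat.exists_tester (hS : IsFat S) (hd : 1 ≤ d) : ∃ C : ℝ, 0 < C ∧ ∀ (ε : ℝ) (L n : ℕ),
    0 < ε → 1 ≤ L → 12 * d < 2 ^ L * ε → 2 ^ L * ε ≤ 24 * d →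
    C * (L : ℝ) ^ 3 * ε ^ (-max (2 : ℝ) ((d : ℝ) / 2)) ≤ n →
    ∃ T : Tester S (n + n), T.Solves (uniform S) ε := by
  have hd' : (1 : ℝ) ≤ d := by exact_mod_cast hd
  have hvol := hS.volume_real_pos hd
  have := hS.isProbabilityMeasure_uniform hd
  set B : ℝ := 3 ^ d / volume.real S with hB
  have hB0 : 0 < B := by positivity
  set A : ℝ := 24 * d with hA
  have hA1 : 1 ≤ A := by linarith
  -- With `θ i` of order `(2 ^ i * ε) ^ 2 / (E ^ 2 * 2 ^ (i d))` and cell masses at most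
  -- `B / 2 ^ (i d)`, level `i` needs about `√L (1 + B) E ^ 2 2 ^ (i d / 2) / (2 ^ i * ε) ^ 2`
  -- samples.
  refine ⟨100 * (1 + B) * A ^ 2 * A ^ max 4 d, by positivity, fun ε L n hε hL hL1 hL2 hn => ?_⟩
  have hL' : (1 : ℝ) ≤ L := by exact_mod_cast hL
  set F := ε ^ (-max (2 : ℝ) ((d : ℝ) / 2)) with hF
  have hF0 : 0 < F := Real.rpow_pos_of_pos hε _
  set E : ℝ := A * L with hE
  have hE1 : A ≤ E := le_mul_of_one_le_right (by linarith) hL'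
  have hE0 : 0 < E := by linarith
  -- A single inequality that implies the three conditions on the sample size at each level.
  have hmain : ∀ i < L, 100 ^ 2 * (L * (1 + B) ^ 2) * E ^ 4 *
      (((2 : ℝ) ^ (i + 1)) ^ d / (2 ^ (i + 1) * ε) ^ 4) ≤ (n : ℝ) ^ 2 := fun i hi => by
    have hu1 : (1 : ℝ) ≤ 2 ^ (i + 1) := one_le_pow₀ (by norm_num)
    have huA : (2 : ℝ) ^ (i + 1) * ε ≤ A := by
      refine le_trans ?_ hL2
      gcongr
      · norm_num
      · omega
    have h1 := pow_div_pow_le_rate (d := d) hu1 hε hA1 huA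
    rw [← rate_sq d hε, ← hF] at h1
    have hAm : 1 ≤ A ^ max 4 d := one_le_pow₀ hA1
    calc _ ≤ 100 ^ 2 * (L * (1 + B) ^ 2) * E ^ 4 * (A ^ max 4 d * F ^ 2) := by gcongr
      _ ≤ 100 ^ 2 * (L ^ 2 * (1 + B) ^ 2) * E ^ 4 * ((A ^ max 4 d) ^ 2 * F ^ 2) := by
          gcongr
          · exact le_self_pow₀ hL' (by norm_num)
          · exact le_self_pow₀ hAm (by norm_num)
      _ = (100 * (1 + B) * A ^ 2 * A ^ max 4 d * (L : ℝ) ^ 3 * F) ^ 2 := by rw [hE]; ring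
      _ ≤ (n : ℝ) ^ 2 := pow_le_pow_left₀ (by positivity) hn 2
  have hθv : ∀ i, (ε * 2 ^ i / E) ^ 2 / (Fintype.card (Fin d → Fin (2 ^ i)) : ℝ) =
      (2 ^ i * ε) ^ 2 / (E ^ 2 * ((2 : ℝ) ^ i) ^ d) := fun i => by
    have : (Fintype.card (Fin d → Fin (2 ^ i)) : ℝ) = ((2 : ℝ) ^ i) ^ d := by simp
    rw [this, div_pow, div_div, mul_comm ε]
  refine exists_tester_solves (uniform S) (fun i => hS.label i) hS.measurable_label
    hS.label_zero hS.label_coarse (fun i => 3 * d / 2 ^ i) (fun i => by positivity)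
    hS.dist_le_of_label_eq L (η := fun i => ε * 2 ^ i / E) (b := fun i => B / (2 ^ i) ^ d)
    (fun i => by positivity) (fun i j => hS.uniform_real_label_le hd i j) ?_ (n := n)
    (θ := fun i => (2 ^ i * ε) ^ 2 / (E ^ 2 * ((2 : ℝ) ^ i) ^ d))
    (fun i => (hθv i).symm) (fun i hi => ?_) (fun i hi => ?_) (fun i hi => ?_)
  · have h1 : (3 * d : ℝ) / 2 ^ L < ε / 4 := by
      rw [div_lt_iff₀ (by positivity)]; linarith
    have h2 : ∀ i ∈ Finset.range L, (3 * d : ℝ) / 2 ^ i * (ε * 2 ^ (i + 1) / E) =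
        ε / (4 * L) := fun i _ => by
      rw [hE, hA, pow_succ]
      field_simp
      norm_num
    rw [Finset.sum_congr rfl h2, Finset.sum_const, Finset.card_range, nsmul_eq_mul]
    have h3 : (L : ℝ) * (ε / (4 * L)) = ε / 4 := by field_simp
    linarith
  all_goals
    have h := hmain i hi
    set u : ℝ := 2 ^ (i + 1) with hu
    have hu1 : (1 : ℝ) ≤ u := one_le_pow₀ (by norm_num)
    have hu0 : 0 < u := by linarith
    have hud : 1 ≤ u ^ d := one_le_pow₀ hu1
    have huE : u * ε ≤ E := by
      refine le_trans ?_ (hL2.trans hE1)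
      rw [hu]
      gcongr
      · norm_num
      · omega
    have hB1 : 1 ≤ (1 + B) ^ 2 := one_le_pow₀ (by linarith)
    have hBB : B ≤ (1 + B) ^ 2 := by nlinarith
  · calc 100 ^ 2 * L * (B / u ^ d) = 100 ^ 2 * (L * B) * E ^ 4 * (u ^ d / (u * ε) ^ 4) *
          ((u * ε) ^ 2 / (E ^ 2 * u ^ d)) ^ 2 := by
          field_simp
      _ ≤ 100 ^ 2 * (L * (1 + B) ^ 2) * E ^ 4 * (u ^ d / (u * ε) ^ 4) *
          ((u * ε) ^ 2 / (E ^ 2 * u ^ d)) ^ 2 := by gcongr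
      _ ≤ (n : ℝ) ^ 2 * ((u * ε) ^ 2 / (E ^ 2 * u ^ d)) ^ 2 := by gcongr
      _ = _ := by ring
  · have h1 : (u * ε) ^ 2 / E ^ 2 ≤ 1 := by
      rw [← div_pow]; exact pow_le_one₀ (by positivity) ((div_le_one hE0).2 huE)
    have h2 : 1 ≤ L * (1 + B) ^ 2 := one_le_mul_of_one_le_of_one_le hL' hB1
    calc (100 : ℝ) ^ 2 = 100 ^ 2 * 1 * 1 := by ring
      _ ≤ 100 ^ 2 * (L * (1 + B) ^ 2) * (E ^ 2 / (u * ε) ^ 2) := by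
          gcongr
          rw [one_le_div (by positivity)]
          gcongr
      _ = 100 ^ 2 * (L * (1 + B) ^ 2) * E ^ 4 * (u ^ d / (u * ε) ^ 4) *
          ((u * ε) ^ 2 / (E ^ 2 * u ^ d)) := by field_simp
      _ ≤ _ := by gcongr
  · refine (sq_le_sq₀ (by positivity) (by positivity)).1 ?_
    calc (100 * (B / u ^ d)) ^ 2 = 100 ^ 2 * (1 * B ^ 2) * 1 / (u ^ d * u ^ d) := by
          field_simp
      _ ≤ 100 ^ 2 * (L * (1 + B) ^ 2) * u ^ d / (u ^ d * u ^ d) := by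
          gcongr; linarith
      _ = 100 ^ 2 * (L * (1 + B) ^ 2) * E ^ 4 * (u ^ d / (u * ε) ^ 4) *
          ((u * ε) ^ 2 / (E ^ 2 * u ^ d)) ^ 2 := by field_simp
      _ ≤ (n : ℝ) ^ 2 * ((u * ε) ^ 2 / (E ^ 2 * u ^ d)) ^ 2 := by gcongr
      _ = _ := by ring

/-- A tester for a fat set has at least `c * ε ^ (- max 2 (d / 2))` samples: perturb either two
large cells by a factor `1 ± a` with `a` of order `ε`, or cells of size of order `ε` by a constant
factor. -/
lemma IsFat.exists_le_of_solves (hS : IsFat S) (hd : 1 ≤ d) : ∃ c κ : ℝ, 0 < c ∧ 0 < κ ∧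
    ∀ (ε : ℝ) (n : ℕ), 0 < ε → ε ≤ κ → (∃ T : Tester S n, T.Solves (uniform S) ε) →
    c * ε ^ (-max (2 : ℝ) ((d : ℝ) / 2)) ≤ n := by
  have hd' : (0 : ℝ) < d := by exact_mod_cast hd
  have hvol := hS.volume_real_pos hd
  set κ : ℝ := 1 / (8 * d * (4 * d) ^ d * volume.real S) with hκ
  have hκ0 : 0 < κ := by positivity
  set γ : ℝ := min (κ ^ 4) ((κ / 2) ^ d) / 5 with hγ
  have hγ0 : 0 < γ := by positivity
  refine ⟨√γ, κ, Real.sqrt_pos.2 hγ0, hκ0, fun ε n hε hεκ ⟨T, hT⟩ => ?_⟩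
  refine (sq_le_sq₀ (by positivity) (Nat.cast_nonneg n)).1 ?_
  rw [mul_pow, Real.sq_sqrt hγ0.le, rate_sq d hε, ← div_eq_mul_inv, div_le_iff₀ (by positivity)]
  rcases le_total d 4 with h4 | h4
  · rw [max_eq_left h4]
    have h := pow_le_of_solves hS hd (K := 1) le_rfl (a := ε / κ) (by positivity)
      ((div_le_one hκ0).2 hεκ) (ε := ε) (by
        rw [← hκ, div_mul_cancel₀ _ hκ0.ne', Nat.cast_one, div_one]) T hT
    rw [Nat.cast_one, one_pow, div_pow, div_mul_eq_mul_div, ← mul_div_assoc,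
      le_div_iff₀ (by positivity)] at h
    have : γ ≤ κ ^ 4 / 5 := by rw [hγ]; gcongr; exact min_le_left _ _
    linarith
  · rw [max_eq_right h4]
    have hκε : 1 ≤ κ / ε := (one_le_div hε).2 hεκ
    have hK : 1 ≤ ⌊κ / ε⌋₊ := Nat.le_floor (by simpa using hκε)
    have hK' : (1 : ℝ) ≤ ⌊κ / ε⌋₊ := by exact_mod_cast hK
    have hKle : (⌊κ / ε⌋₊ : ℝ) ≤ κ / ε := Nat.floor_le (by positivity)
    have h := pow_le_of_solves hS hd hK zero_le_one le_rfl (ε := ε) (by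
      rw [← hκ, one_mul, le_div_iff₀ (by linarith)]
      rw [le_div_iff₀ hε] at hKle
      linarith) T hT
    have hlow : κ / 2 / ε ≤ (⌊κ / ε⌋₊ : ℝ) := by
      have := Nat.lt_floor_add_one (κ / ε)
      have e : κ / 2 / ε = κ / ε / 2 := by ring
      rw [e]
      linarith
    have h1 := (pow_le_pow_left₀ (by positivity) hlow d).trans h
    rw [div_pow, div_le_iff₀ (by positivity), one_pow, one_mul] at h1
    have : γ ≤ (κ / 2) ^ d / 5 := by rw [hγ]; gcongr; exact min_le_right _ _
    linarith

lemma IsFat.isThetaTilde_sampleComplexity (hS : IsFat S) (hd : 1 ≤ d) :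
    IsThetaTilde (fun ε => sampleComplexity (uniform S) ε)
      (fun ε => ε ^ (-max (2 : ℝ) ((d : ℝ) / 2))) := by
  have hd' : (1 : ℝ) ≤ d := by exact_mod_cast hd
  obtain ⟨C, hC, hup⟩ := hS.exists_tester hd
  obtain ⟨c, κ, hc, hκ, hlow⟩ := hS.exists_le_of_solves hd
  refine ⟨c, 2 * (64 * C + 1), 3, hc, by positivity, ?_⟩
  -- For small `ε`, the number of scales is at most `4 * log (1 / ε)`.
  have hA : (1 : ℝ) < 24 * d := by linarith
  have hev : ∀ᶠ ε : ℝ in 𝓝[>] 0, ε < min (min κ 1) (min (Real.exp (-1)) (1 / (24 * d))) := by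
    refine nhdsWithin_le_nhds (Iio_mem_nhds ?_)
    positivity
  filter_upwards [hev, self_mem_nhdsWithin] with ε hεs hε0
  have hε : 0 < ε := hε0
  obtain ⟨⟨hεκ, hε1⟩, hεe, hεA⟩ := by simpa only [lt_min_iff] using hεs
  set ℓ := Real.log (1 / ε) with hℓ
  set F := ε ^ (-max (2 : ℝ) ((d : ℝ) / 2)) with hF
  have hF1 : 1 ≤ F := one_le_rate d hε hε1.le
  have hℓ1 : 1 ≤ ℓ := by
    rw [hℓ, one_div, Real.log_inv, le_neg]
    exact (Real.log_le_iff_le_exp hε).2 hεe.le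
  have hℓ3 : 1 ≤ ℓ ^ 3 := one_le_pow₀ hℓ1
  constructor
  · refine le_iInf₂ fun n hn => ?_
    rw [← ENNReal.ofReal_natCast]
    refine ENNReal.ofReal_le_ofReal ((div_le_self (by positivity) hℓ3).trans ?_)
    exact hlow ε n hε hεκ.le hn
  · obtain ⟨m, hm1, hm2⟩ := exists_nat_pow_near (x := 12 * d / ε) (y := (2 : ℝ))
      (by rw [one_le_div hε]; linarith) (by norm_num)
    rw [le_div_iff₀ hε] at hm1
    rw [div_lt_iff₀ hε] at hm2
    set L := m + 1 with hL
    have hL2 : 2 ^ L * ε ≤ 24 * d := by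
      rw [hL, pow_succ]; linarith
    have hLℓ : (L : ℝ) ≤ 4 * ℓ := by
      have h1 : (2 : ℝ) ^ L ≤ (1 / ε) ^ 2 := by
        have h2 : 24 * (d : ℝ) ≤ 1 / ε := by
          rw [le_div_iff₀ hε]
          rw [lt_div_iff₀ (by linarith)] at hεA
          linarith
        calc (2 : ℝ) ^ L ≤ 24 * d / ε := (le_div_iff₀ hε).2 hL2
          _ = 24 * d * (1 / ε) := by ring
          _ ≤ 1 / ε * (1 / ε) := by gcongr
          _ = _ := by ring
      have h3 := Real.log_le_log (by positivity) h1
      rw [Real.log_pow, Real.log_pow, ← hℓ] at h3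
      have h4 : (1 / 2 : ℝ) ≤ Real.log 2 := by linarith [Real.log_two_gt_d9]
      have h5 : (L : ℝ) * (1 / 2) ≤ L * Real.log 2 := by gcongr
      push_cast at h3
      linarith
    set n := ⌈C * (L : ℝ) ^ 3 * F⌉₊ with hn
    have hT := hup ε L n hε (by omega) hm2 hL2 (Nat.le_ceil _)
    refine (iInf₂_le (n + n) hT).trans ?_
    rw [← ENNReal.ofReal_natCast]
    refine ENNReal.ofReal_le_ofReal ?_
    have hn1 : (n : ℝ) ≤ C * (L : ℝ) ^ 3 * F + 1 := (Nat.ceil_lt_add_one (by positivity)).le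
    have hL3 : (L : ℝ) ^ 3 ≤ 64 * ℓ ^ 3 := by
      calc (L : ℝ) ^ 3 ≤ (4 * ℓ) ^ 3 := by gcongr
        _ = _ := by ring
    have h6 : C * (L : ℝ) ^ 3 * F ≤ C * (64 * ℓ ^ 3) * F := by gcongr
    have h7 : 1 ≤ F * ℓ ^ 3 := one_le_mul_of_one_le_of_one_le hF1 hℓ3
    push_cast
    linarith

end Complexity

end WIT

theorem mainTheorem2 (d : ℕ) (hd : 1 ≤ d) :
    WIT.IsThetaTilde (fun ε => WIT.sampleComplexity (WIT.uniform (WIT.cube d)) ε)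
        (fun ε => ε ^ (-max (2 : ℝ) ((d : ℝ) / 2))) ∧
      WIT.IsThetaTilde (fun ε => WIT.sampleComplexity (WIT.uniform (WIT.unitBall d)) ε)
        (fun ε => ε ^ (-max (2 : ℝ) ((d : ℝ) / 2))) :=
  ⟨(WIT.isFat_cube hd).isThetaTilde_sampleComplexity hd,
    (WIT.isFat_unitBall hd).isThetaTilde_sampleComplexity hd⟩
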